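/- Let $\mathrm{Bir}(\mathbb{P}^2)$ be the group of birational maps of the complex projective plane. The degree of $f\in\mathrm{Bir}(\mathbb{P}^2)$, $f=(f_0:f_1:f_2)$ with $f_i\in\mathbb{C}[x,y,z]$ homogeneous of the same degree and without common factor, is $\deg f=\deg f_i$, and its dynamical degree is $\lambda(f)=\lim_{n\to\infty}(\deg f^n)^{1/n}$; $f$ is called hyperbolic if $\lambda(f)>1$. An injective morphism $\theta\colon\mathrm{SL}(2,\mathbb{Z})\to\mathrm{Bir}(\mathbb{P}^2)$ is called a hyperbolic embedding if every element of infinite order of its image is hyperbolic. Let $R=\begin{pmatrix}1&1\\0&1\end{pmatrix}$ and $S=\begin{pmatrix}0&1\\-1&0\end{pmatrix}$, and let $\theta_e\colon\mathrm{SL}(2,\mathbb{Z})\to\mathrm{Bir}(\mathbb{P}^2)$ be the morphism $\begin{pmatrix}a&b\\c&d\end{pmatrix}\mapsto(ax+by:cx+dy:z)$. Let $k>0$ be an even integer, and let $\mu\in\mathbb{C}^*$ be such that the point $p=(\mu:1:0)$ of the line $z=0$ has trivial isotropy group under the action of $\mathrm{PSL}(2,\mathbb{Z})$ induced by $\theta_e$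 on this line. Put $\psi'=(x^k:yx^{k-1}+z^k:zx^{k-1})$, $\alpha=(x+\mu y:y:z)$ and $\psi=\alpha\psi'\alpha^{-1}$. Then there is a unique morphism $\theta_k\colon\mathrm{SL}(2,\mathbb{Z})\to\mathrm{Bir}(\mathbb{P}^2)$ with $$\theta_k(S)=\theta_e(S)=(y:-x:z),\qquad \theta_k(RS)=\psi\,\theta_e(RS)\,\psi^{-1},$$ and it has the following properties. 1. For every positive integer $m$ and all $a_1,\dots,a_m,b_1,\dots,b_m\in\{\pm1\}$, the birational map $$\theta_k\bigl(S^{b_m}(RS)^{a_m}\cdots S^{b_1}(RS)^{a_1}\bigr)$$ has dynamical degree $k^{2m}$. 2. The map $\theta_k$ is a hyperbolic embedding. 3. Every element of $\theta_k(\mathrm{SL}(2,\mathbb{Z}))$ has a dynamical degree (the limit exists), and the set of all dynamical degrees of elements of $\theta_k(\mathrm{SL}(2,\mathbb{Z}))$ is $\{1,k^2,k^4,k^6,\dots\}$. -/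

import Mathlib

open MvPolynomial Filter Topology
open scoped MatrixGroups Matrix

noncomputable section

namespace Cremona

/-- Polynomials in the homogeneous coordinates `x = X 0`, `y = X 1`, `z = X 2` of the plane. -/
abbrev Poly : Type := MvPolynomial (Fin 3) ℂ

/-- Substitution of triples of polynomials: `(comp F G) i = F i (G 0, G 1, G 2)`. -/
def comp (F G : Fin 3 → Poly) : Fin 3 → Poly := fun i => bind₁ G (F i)

/-- `F` and `G` have proportional values, i.e. they define the same map to the plane. -/
def Proportional (F G : Fin 3 → Poly) : Prop := ∀ i j, F i * G j = F j * G i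

/-- `F` is, up to a common non-zero factor, the triple `(x, y, z)`. -/
def IsIdentity (F : Fin 3 → Poly) : Prop := ∃ h : Poly, h ≠ 0 ∧ ∀ i, F i = h * X i

/-- A triple of homogeneous polynomials of the same degree (common factors being allowed) that
defines a birational map of the plane, together with a triple defining the inverse map. -/
structure BirTriple where
  fwd : Fin 3 → Poly
  bwd : Fin 3 → Poly
  fwd_hom : ∃ d : ℕ, ∀ i, (fwd i).IsHomogeneous d
  bwd_hom : ∃ d : ℕ, ∀ i, (bwd i).IsHomogeneous d
  bwd_fwd : IsIdentity (comp bwd fwd)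
  fwd_bwd : IsIdentity (comp fwd bwd)

theorem comp_assoc (F G H : Fin 3 → Poly) : comp (comp F G) H = comp F (comp G H) := by
  funext i
  exact bind₁_bind₁ G H (F i)

theorem comp_X (F : Fin 3 → Poly) : comp F X = F := by
  funext i
  exact aeval_X_left_apply (F i)

theorem X_comp (F : Fin 3 → Poly) : comp X F = F := by
  funext i
  simp [comp]

theorem comp_hom {F G : Fin 3 → Poly} (hF : ∃ d : ℕ, ∀ i, (F i).IsHomogeneous d)
    (hG : ∃ d : ℕ, ∀ i, (G i).IsHomogeneous d) :
    ∃ d : ℕ, ∀ i, (comp F G i).IsHomogeneous d := by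
  obtain ⟨d, hd⟩ := hF
  obtain ⟨e, he⟩ := hG
  exact ⟨e * d, fun i => (hd i).aeval G he⟩

theorem bind_mul {p : Poly} {d : ℕ} (hp : p.IsHomogeneous d) (c : Poly) (G : Fin 3 → Poly) :
    bind₁ (fun i => c * G i) p = c ^ d * bind₁ G p := by
  simp only [bind₁, aeval_def, eval₂_eq, Finset.mul_sum]
  refine Finset.sum_congr rfl fun m hm => ?_
  have hdeg : ∑ i ∈ m.support, m i = d := (hp.degree_eq_sum_deg_support hm).symm
  simp only [mul_pow, Finset.prod_mul_distrib, Finset.prod_pow_eq_pow_sum, hdeg]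
  ring

theorem hom_of_mul_X {h : Poly} {d : ℕ} (hh : (h * X 0).IsHomogeneous d) :
    h.IsHomogeneous (d - 1) := by
  intro m hm
  have h1 : coeff (m + Finsupp.single 0 1) (h * X 0) ≠ 0 := by
    rwa [coeff_mul_X]
  have h2 := hh h1
  rw [map_add] at h2
  simp [Finsupp.weight_single] at h2
  omega

theorem bind_ne_zero (f : BirTriple) {h : Poly} {d : ℕ} (hh : h.IsHomogeneous d) (h0 : h ≠ 0) :
    bind₁ f.fwd h ≠ 0 := by
  intro hz
  obtain ⟨e, he, hE⟩ := f.fwd_bwd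
  have h1 : bind₁ f.bwd (bind₁ f.fwd h) = e ^ d * h := by
    rw [bind₁_bind₁]
    have : (fun i => bind₁ f.bwd (f.fwd i)) = fun i => e * X i := funext hE
    rw [this, bind_mul hh]
    congr 1
    exact aeval_X_left_apply h
  rw [hz, map_zero] at h1
  exact mul_ne_zero (pow_ne_zero _ he) h0 h1.symm

/-- Exchanging a map and its inverse. -/
def BirTriple.symm (f : BirTriple) : BirTriple :=
  ⟨f.bwd, f.fwd, f.bwd_hom, f.fwd_hom, f.fwd_bwd, f.bwd_fwd⟩

theorem BirTriple.fwd_ne_zero (f : BirTriple) : ∃ i, f.fwd i ≠ 0 := by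
  by_contra! hz
  obtain ⟨e, he, hE⟩ := f.fwd_bwd
  have := hE 0
  simp only [comp, hz, map_zero] at this
  exact mul_ne_zero he (X_ne_zero 0) this.symm

theorem isIdentity_comp {f g : BirTriple} :
    IsIdentity (comp (comp g.bwd f.bwd) (comp f.fwd g.fwd)) := by
  obtain ⟨h, h0, hf⟩ := f.bwd_fwd
  obtain ⟨h', h0', hg⟩ := g.bwd_fwd
  obtain ⟨d, hd⟩ := g.bwd_hom
  have hhom : h.IsHomogeneous ((comp_hom f.bwd_hom f.fwd_hom).choose - 1) := by
    apply hom_of_mul_X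
    rw [← hf 0]
    exact (comp_hom f.bwd_hom f.fwd_hom).choose_spec 0
  refine ⟨(bind₁ g.fwd h) ^ d * h',
    mul_ne_zero (pow_ne_zero _ (bind_ne_zero g hhom h0)) h0', fun i => ?_⟩
  have h1 : comp f.bwd (comp f.fwd g.fwd) = fun i => bind₁ g.fwd h * g.fwd i := by
    rw [← comp_assoc]
    funext j
    change bind₁ g.fwd (comp f.bwd f.fwd j) = _
    rw [hf j, map_mul, bind₁_X_right]
  rw [comp_assoc, h1]
  change bind₁ _ (g.bwd i) = _
  rw [bind_mul (hd i)]
  have := hg i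
  simp only [comp] at this
  rw [this, mul_assoc]

/-- The identity `(x : y : z)`. -/
def BirTriple.one : BirTriple where
  fwd := X
  bwd := X
  fwd_hom := ⟨1, fun i => isHomogeneous_X ℂ i⟩
  bwd_hom := ⟨1, fun i => isHomogeneous_X ℂ i⟩
  bwd_fwd := ⟨1, one_ne_zero, fun i => by simp [comp]⟩
  fwd_bwd := ⟨1, one_ne_zero, fun i => by simp [comp]⟩

/-- The composition `f ∘ g` (first `g`, then `f`). -/
def BirTriple.mul (f g : BirTriple) : BirTriple where
  fwd := comp f.fwd g.fwd
  bwd := comp g.bwd f.bwd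
  fwd_hom := comp_hom f.fwd_hom g.fwd_hom
  bwd_hom := comp_hom g.bwd_hom f.bwd_hom
  bwd_fwd := isIdentity_comp
  fwd_bwd := isIdentity_comp (f := g.symm) (g := f.symm)

theorem Proportional.refl (F : Fin 3 → Poly) : Proportional F F := fun _ _ => mul_comm _ _

theorem Proportional.symm {F G : Fin 3 → Poly} (h : Proportional F G) : Proportional G F :=
  fun i j => by rw [mul_comm, h j i, mul_comm]

theorem Proportional.trans {F G H : Fin 3 → Poly} (hG : ∃ k, G k ≠ 0)
    (h1 : Proportional F G) (h2 : Proportional G H) : Proportional F H := by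
  intro i j
  obtain ⟨k, hk⟩ := hG
  apply mul_right_cancel₀ hk
  linear_combination F i * h2 k j + H k * h1 i j + F j * h2 i k

theorem Proportional.comp_right {F F' : Fin 3 → Poly} (h : Proportional F F')
    (G : Fin 3 → Poly) : Proportional (comp F G) (comp F' G) := by
  intro i j
  simp only [comp, ← map_mul, h i j]

theorem Proportional.comp_left {F F' : Fin 3 → Poly} (h : Proportional F F')
    (hF : ∃ k, F k ≠ 0) (hF' : ∃ k, F' k ≠ 0)
    {H : Fin 3 → Poly} (hH : ∃ d : ℕ, ∀ i, (H i).IsHomogeneous d) :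
    Proportional (comp H F) (comp H F') := by
  obtain ⟨k, hk⟩ := hF
  obtain ⟨d, hd⟩ := hH
  have hk' : F' k ≠ 0 := by
    intro hz
    obtain ⟨j, hj⟩ := hF'
    have := h k j
    rw [hz, mul_zero] at this
    exact mul_ne_zero hk hj this
  have key : ∀ i, F' k ^ d * comp H F i = F k ^ d * comp H F' i := by
    intro i
    simp only [comp]
    rw [← bind_mul (hd i), ← bind_mul (hd i)]
    congr 2
    funext j
    rw [mul_comm, h j k]
  intro i j
  apply mul_left_cancel₀ (pow_ne_zero d hk')
  linear_combination comp H F' j * key i - comp H F' i * key j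

theorem proportional_of_mul {F G : Fin 3 → Poly} (h : Poly) (hF : ∀ i, F i = h * G i) :
    Proportional F G := by
  intro i j
  rw [hF i, hF j]
  ring

/-- Two triples are identified when they define the same birational map. -/
instance birSetoid : Setoid BirTriple where
  r f g := Proportional f.fwd g.fwd
  iseqv := ⟨fun f => Proportional.refl f.fwd, fun h => h.symm,
    fun {_ g _} h1 h2 => h1.trans g.fwd_ne_zero h2⟩

theorem equiv_mul {f f' g g' : BirTriple} (hf : Proportional f.fwd f'.fwd)
    (hg : Proportional g.fwd g'.fwd) : Proportional (f.mul g).fwd (f'.mul g').fwd :=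
  (hg.comp_left g.fwd_ne_zero g'.fwd_ne_zero f.fwd_hom).trans (f.mul g').fwd_ne_zero
    (hf.comp_right g'.fwd)

theorem equiv_symm {f g : BirTriple} (h : Proportional f.fwd g.fwd) :
    Proportional f.bwd g.bwd := by
  have h1 : Proportional (X : Fin 3 → Poly) (comp g.fwd f.bwd) := by
    obtain ⟨e, _, hE⟩ := f.fwd_bwd
    exact (proportional_of_mul e hE).symm.trans (f.mul f.symm).fwd_ne_zero (h.comp_right f.bwd)
  have h2 : Proportional g.bwd (comp g.bwd (comp g.fwd f.bwd)) := by
    have := h1.comp_left BirTriple.one.fwd_ne_zero (g.mul f.symm).fwd_ne_zero g.bwd_hom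
    rwa [comp_X] at this
  have h3 : Proportional (comp g.bwd (comp g.fwd f.bwd)) f.bwd := by
    obtain ⟨e, _, hE⟩ := g.bwd_fwd
    rw [← comp_assoc]
    refine proportional_of_mul (bind₁ f.bwd e) fun i => ?_
    change bind₁ f.bwd (comp g.bwd g.fwd i) = _
    rw [hE i, map_mul, bind₁_X_right]
  exact (h2.trans (g.symm.mul (g.mul f.symm)).fwd_ne_zero h3).symm

end Cremona

/-- The Cremona group `Bir(ℙ²)` over `ℂ`: birational maps of the complex projective plane. -/
def Cremona : Type := Quotient Cremona.birSetoid

namespace Cremona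

/-- The birational map defined by a triple. -/
def mk (f : BirTriple) : Cremona := Quotient.mk birSetoid f

theorem mk_eq_mk {f g : BirTriple} : mk f = mk g ↔ Proportional f.fwd g.fwd :=
  Quotient.eq (r := birSetoid)

/-- The group law of `Bir(ℙ²)` is composition: `f * g = f ∘ g`. -/
instance : Group Cremona where
  mul := Quotient.map₂ BirTriple.mul fun _ _ hf _ _ hg => equiv_mul hf hg
  one := mk BirTriple.one
  inv := Quotient.map BirTriple.symm fun _ _ h => equiv_symm h
  mul_assoc := by
    rintro ⟨f⟩ ⟨g⟩ ⟨h⟩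
    apply Quotient.sound
    change Proportional (comp (comp f.fwd g.fwd) h.fwd) (comp f.fwd (comp g.fwd h.fwd))
    rw [comp_assoc]
    exact Proportional.refl _
  one_mul := by
    rintro ⟨f⟩
    apply Quotient.sound
    change Proportional (comp X f.fwd) f.fwd
    rw [X_comp]
    exact Proportional.refl _
  mul_one := by
    rintro ⟨f⟩
    apply Quotient.sound
    change Proportional (comp f.fwd X) f.fwd
    rw [comp_X]
    exact Proportional.refl _
  inv_mul_cancel := by
    rintro ⟨f⟩
    apply Quotient.sound
    obtain ⟨h, _, hf⟩ := f.bwd_fwd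
    exact proportional_of_mul h hf

/-- The polynomials `F 0, F 1, F 2` have no common factor. -/
def NoCommonFactor (F : Fin 3 → Poly) : Prop := ∀ q : Poly, (∀ i, q ∣ F i) → IsUnit q

/-- The degree of a birational map `f`: the common degree of the three homogeneous polynomials of
any triple without common factor that defines `f`. -/
def degree (f : Cremona) : ℕ :=
  sInf {d : ℕ | ∃ F : BirTriple, mk F = f ∧ NoCommonFactor F.fwd ∧
    ∀ i, (F.fwd i).IsHomogeneous d}

/-- `l` is the (first) dynamical degree of `f`: the limit of `(deg fⁿ)^(1/n)`. -/
def HasDynamicalDegree (f : Cremona) (l : ℝ) : Prop :=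
  Tendsto (fun n : ℕ => (degree (f ^ n) : ℝ) ^ ((1 : ℝ) / (n : ℝ))) atTop (𝓝 l)

/-- A birational map is hyperbolic if its dynamical degree is greater than `1`. -/
def IsHyperbolic (f : Cremona) : Prop := ∃ l : ℝ, 1 < l ∧ HasDynamicalDegree f l

/-- A hyperbolic embedding of `SL(2, ℤ)` into the Cremona group: an injective morphism such that
each element of infinite order of its image is hyperbolic. -/
def IsHyperbolicEmbedding (θ : SL(2, ℤ) →* Cremona) : Prop :=
  Function.Injective θ ∧ ∀ f ∈ θ.range, ¬ IsOfFinOrder f → IsHyperbolic f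

/-- The matrix `R = (1 1; 0 1)`. -/
def matR : SL(2, ℤ) := ⟨!![1, 1; 0, 1], by simp⟩

/-- The matrix `S = (0 1; -1 0)`. -/
def matS : SL(2, ℤ) := ⟨!![0, 1; -1, 0], by simp⟩

/-- The triple `(a x + b y, c x + d y, z)` attached to the matrix `M = (a b; c d)`. -/
def linearTriple (M : SL(2, ℤ)) : Fin 3 → Poly :=
  ![C (M 0 0 : ℂ) * X 0 + C (M 0 1 : ℂ) * X 1, C (M 1 0 : ℂ) * X 0 + C (M 1 1 : ℂ) * X 1, X 2]

theorem linearTriple_hom (M : SL(2, ℤ)) : ∀ i, (linearTriple M i).IsHomogeneous 1 := by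
  intro i
  fin_cases i
  · exact (isHomogeneous_C_mul_X _ _).add (isHomogeneous_C_mul_X _ _)
  · exact (isHomogeneous_C_mul_X _ _).add (isHomogeneous_C_mul_X _ _)
  · exact isHomogeneous_X _ _

theorem linearTriple_mul (M N : SL(2, ℤ)) :
    comp (linearTriple M) (linearTriple N) = linearTriple (M * N) := by
  funext i
  fin_cases i <;>
    simp [comp, linearTriple, Matrix.mul_apply, Fin.sum_univ_two] <;> ring

theorem linearTriple_one : linearTriple 1 = X := by
  funext i
  fin_cases i <;> simp [linearTriple]

/-- The standard elliptic embedding `θ_e`, sending `(a b; c d)` to `(a x + b y : c x + d y : z)`. -/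
def thetaE : SL(2, ℤ) →* Cremona where
  toFun M := mk
    { fwd := linearTriple M
      bwd := linearTriple M⁻¹
      fwd_hom := ⟨1, linearTriple_hom M⟩
      bwd_hom := ⟨1, linearTriple_hom M⁻¹⟩
      bwd_fwd := ⟨1, one_ne_zero, fun i => by simp [linearTriple_mul, linearTriple_one]⟩
      fwd_bwd := ⟨1, one_ne_zero, fun i => by simp [linearTriple_mul, linearTriple_one]⟩ }
  map_one' := by
    apply mk_eq_mk.2
    change Proportional (linearTriple 1) X
    rw [linearTriple_one]
    exact Proportional.refl _
  map_mul' M N := by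
    apply mk_eq_mk.2
    change Proportional (linearTriple (M * N)) (comp (linearTriple M) (linearTriple N))
    rw [linearTriple_mul]
    exact Proportional.refl _

/-- The triple `(x ^ k, y x ^ (k - 1) + c z ^ k, z x ^ (k - 1))`. -/
def psiTriple (k : ℕ) (c : ℂ) : Fin 3 → Poly :=
  ![X 0 ^ k, X 1 * X 0 ^ (k - 1) + C c * X 2 ^ k, X 2 * X 0 ^ (k - 1)]

theorem psiTriple_hom {k : ℕ} (hk : 0 < k) (c : ℂ) : ∀ i, (psiTriple k c i).IsHomogeneous k := by
  have h1 : ∀ j : Fin 3, (X j * X 0 ^ (k - 1) : Poly).IsHomogeneous k := by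
    intro j
    have := (isHomogeneous_X ℂ j).mul (isHomogeneous_X_pow (R := ℂ) (0 : Fin 3) (k - 1))
    rwa [Nat.add_sub_cancel' hk] at this
  intro i
  fin_cases i
  · exact isHomogeneous_X_pow _ _
  · exact (h1 1).add (isHomogeneous_C_mul_X_pow _ _ _)
  · exact h1 2

theorem psiTriple_comp {k : ℕ} (hk : 0 < k) {c c' : ℂ} (hc : c + c' = 0) :
    IsIdentity (comp (psiTriple k c) (psiTriple k c')) := by
  obtain ⟨n, rfl⟩ : ∃ n, k = n + 1 := ⟨k - 1, by omega⟩
  refine ⟨X 0 ^ (n * (n + 2)), pow_ne_zero _ (X_ne_zero 0), fun i => ?_⟩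
  have hc' : (C c : Poly) = - C c' := by
    rw [← map_neg, eq_neg_of_add_eq_zero_left hc]
  fin_cases i
  · simp [comp, psiTriple]
    ring
  · simp [comp, psiTriple, hc']
    ring
  · simp [comp, psiTriple]
    ring

/-- The birational map `ψ' = (x ^ k : y x ^ (k - 1) + z ^ k : z x ^ (k - 1))`. -/
def psi' (k : ℕ) (hk : 0 < k) : Cremona := mk
  { fwd := psiTriple k 1
    bwd := psiTriple k (-1)
    fwd_hom := ⟨k, psiTriple_hom hk 1⟩
    bwd_hom := ⟨k, psiTriple_hom hk (-1)⟩
    bwd_fwd := psiTriple_comp hk (by ring)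
    fwd_bwd := psiTriple_comp hk (by ring) }

/-- The triple `(x + μ y, y, z)`. -/
def shearTriple (μ : ℂ) : Fin 3 → Poly := ![X 0 + C μ * X 1, X 1, X 2]

theorem shearTriple_hom (μ : ℂ) : ∀ i, (shearTriple μ i).IsHomogeneous 1 := by
  intro i
  fin_cases i
  · exact (isHomogeneous_X _ _).add (isHomogeneous_C_mul_X _ _)
  · exact isHomogeneous_X _ _
  · exact isHomogeneous_X _ _

theorem shearTriple_comp {μ ν : ℂ} (h : μ + ν = 0) :
    IsIdentity (comp (shearTriple μ) (shearTriple ν)) := by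
  refine ⟨1, one_ne_zero, fun i => ?_⟩
  have hc : (C μ : Poly) = - C ν := by
    rw [← map_neg, eq_neg_of_add_eq_zero_left h]
  fin_cases i <;> simp [comp, shearTriple, hc]

/-- The automorphism `(x + μ y : y : z)` of the plane. -/
def shear (μ : ℂ) : Cremona := mk
  { fwd := shearTriple μ
    bwd := shearTriple (-μ)
    fwd_hom := ⟨1, shearTriple_hom μ⟩
    bwd_hom := ⟨1, shearTriple_hom (-μ)⟩
    bwd_fwd := shearTriple_comp (by ring)
    fwd_bwd := shearTriple_comp (by ring) }

/-- The map `ψ`: the conjugate of `ψ'` by `(x + μ y : y : z)`, which maps `(0 : 1 : 0)` to the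
point `p = (μ : 1 : 0)`. -/
def psi (k : ℕ) (hk : 0 < k) (μ : ℂ) : Cremona := shear μ * psi' k hk * (shear μ)⁻¹

/-- The defining values of the twisted embedding `θ_k` on the generators `S` and `RS`. -/
def IsTwist (k : ℕ) (hk : 0 < k) (μ : ℂ) (θ : SL(2, ℤ) →* Cremona) : Prop :=
  θ matS = thetaE matS ∧
  θ (matR * matS) = psi k hk μ * thetaE (matR * matS) * (psi k hk μ)⁻¹

/-- The point `(μ : 1)` of the projective line has trivial isotropy group in `PSL(2, ℤ)`: only `1`
and `-1` in `SL(2, ℤ)` fix it. -/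
def TrivialIsotropy (μ : ℂ) : Prop :=
  ∀ M : SL(2, ℤ),
    (∃ t : ℂ, t ≠ 0 ∧ (M : Matrix (Fin 2) (Fin 2) ℤ).map (Int.cast : ℤ → ℂ) *ᵥ ![μ, 1]
      = t • ![μ, 1]) →
    M = 1 ∨ M = -1

/-- The element `S^{b_m} (RS)^{a_m} ⋯ S^{b_1} (RS)^{a_1}` of `SL(2, ℤ)`. -/
def word {m : ℕ} (a b : Fin m → ℤ) : SL(2, ℤ) :=
  (List.ofFn fun i => matS ^ b i * (matR * matS) ^ a i).reverse.prod

end Cremona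

end

/-!
Write `U = RS`. The group `SL(2, ℤ)` is presented by `S⁴ = U³ = 1` and `S² U = U S²`, and `S²` acts
on the plane as `(x : y : -z)`, which commutes with `ψ` because `k` is even. This gives existence and
uniqueness of `θ` (`exists_monoidHom`, `monoidHom_ext`, `modularPair_twist`). The presentation is
obtained by cyclic reduction (`ModularPair.isConj_cases`): in any group generated by elements `s`, `u`
with these relations, each element is conjugate to a power of `s`, to `s ^ (2 m) u ^ i`, or to a
non-empty product of blocks `s ^ b u ^ a` with `a, b = ±1`. In `SL(2, ℤ)` a non-empty product of blocks
is never `±1` (`blockProd_mat_mem`), and the relations between powers are the expected ones.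

The remaining claims follow once `θ` of a product of `m` blocks is known to have degree exactly
`k ^ (2 m)` (`degree_blockProd`), since powers of such a product are again of this form, the dynamical
degree is invariant under conjugation, and elements of finite order have dynamical degree `1`.

For the degree, note that `ψ` and `ψ⁻¹` have degree `k`, have `p = (μ : 1 : 0)` as their only base
point in the plane, and contract the line `x = μ y` to `p`. On triples `F` they act by
`F ↦ ℓ ^ (k - 1) F ± (F 2) ^ k (μ, 1, 0)` with `ℓ = F 0 - μ F 1`, so that composing with them creates
a common factor only if `ℓ` and `F 2` have one. The prime factors of `F 2` are the curves which the
composition maps into the line `z = 0`, and `ψ` fixes that line pointwise outside `p`; hence such a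
curve is mapped either onto the line or to the image of `p` under a product of elements `S ^ b` and
`U ^ a`, which is not `p` because the isotropy group of `p` is trivial. The predicate `Avoids` expresses
this, relative to a set of matrices that may still be applied, and `Avoids.block` propagates it with the
set `staircase`, for which the necessary facts on alternating products reduce to signs of entries.
-/

namespace Cremona

/-! ### Triples without common factor -/

theorem exists_not_dvd {F : Fin 3 → Poly} (hF : NoCommonFactor F) {p : Poly} (hp : ¬ IsUnit p) :
    ∃ i, ¬ p ∣ F i := by
  by_contra! h
  exact hp (hF p h)

/-- Division by the prime factors of `a`, one at a time. -/
theorem dvd_of_forall_dvd_mul {F : Fin 3 → Poly} (hF : NoCommonFactor F) (a : Poly) :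
    ∀ b : Poly, (∀ i, a ∣ b * F i) → a ∣ b := by
  induction a using UniqueFactorizationMonoid.induction_on_prime with
  | h₁ =>
    intro b h
    obtain ⟨i, hi⟩ := exists_not_dvd hF (p := 0) not_isUnit_zero
    rw [zero_dvd_iff] at hi
    have := h i
    rw [zero_dvd_iff, mul_eq_zero] at this
    rw [this.resolve_right hi]
  | h₂ x hx => exact fun b _ => hx.dvd
  | h₃ a p ha hp ih =>
    intro b h
    obtain ⟨i, hi⟩ := exists_not_dvd hF hp.not_isUnit
    obtain ⟨c, rfl⟩ := (hp.dvd_or_dvd ((dvd_mul_right p a).trans (h i))).resolve_right hi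
    refine mul_dvd_mul_left p (ih c fun j => ?_)
    have := h j
    rw [mul_assoc] at this
    exact (mul_dvd_mul_iff_left hp.ne_zero).1 this

theorem noCommonFactor_X : NoCommonFactor X := by
  intro q hq
  obtain ⟨a, ha⟩ := hq 0
  have hirr : Irreducible (X 0 : Poly) := (X_prime (i := (0 : Fin 3))).irreducible
  rcases hirr.isUnit_or_isUnit ha with h | h
  · exact h
  · have h1 : (X 0 : Poly) ∣ X 1 := by
      rw [ha]
      exact (h.mul_right_dvd).2 (hq 1)
    rw [X_dvd_X] at h1
    simp at h1

theorem dvd_of_proportional {F G : Fin 3 → Poly} (hG : NoCommonFactor G)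
    (h : Proportional F G) (i : Fin 3) : G i ∣ F i :=
  dvd_of_forall_dvd_mul hG _ _ fun j => ⟨F j, by rw [h i j, mul_comm]⟩

/-! ### Factors of homogeneous polynomials -/

/-- The substitution `x ↦ t x`, which separates the homogeneous components of a polynomial by the
powers of the new variable `t`. -/
noncomputable def scale : Poly →ₐ[ℂ] Polynomial Poly :=
  aeval fun i => Polynomial.X * Polynomial.C (X i)

theorem scale_monomial (s : Fin 3 →₀ ℕ) (a : ℂ) :
    scale (monomial s a) = Polynomial.monomial s.degree (monomial s a) := by
  rw [scale, aeval_monomial, ← Polynomial.C_mul_X_pow_eq_monomial, monomial_eq (s := s) (a := a)]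
  simp only [mul_pow, Finsupp.prod, Finset.prod_mul_distrib, Finset.prod_pow_eq_pow_sum,
    map_mul, map_prod, map_pow, Finsupp.degree_apply]
  have : (algebraMap ℂ (Polynomial Poly)) a = Polynomial.C (C a) := rfl
  rw [this]
  ring

theorem coeff_scale (p : Poly) (n : ℕ) : (scale p).coeff n = homogeneousComponent n p := by
  induction p using MvPolynomial.induction_on' with
  | monomial s a =>
    rw [scale_monomial, Polynomial.coeff_monomial,
      homogeneousComponent_of_mem (isHomogeneous_monomial a rfl)]
    simp only [eq_comm]
  | add p q hp hq => rw [map_add, Polynomial.coeff_add, hp, hq, map_add]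

theorem scale_injective : Function.Injective scale := by
  intro p q h
  have hc : ∀ n, homogeneousComponent n p = homogeneousComponent n q := fun n => by
    rw [← coeff_scale, h, coeff_scale]
  ext s
  have := congrArg (coeff s) (hc s.degree)
  simpa [coeff_homogeneousComponent] using this

theorem scale_of_isHomogeneous {p : Poly} {d : ℕ} (hp : p.IsHomogeneous d) :
    scale p = Polynomial.monomial d p := by
  ext1 n
  rw [coeff_scale, homogeneousComponent_of_mem hp, Polynomial.coeff_monomial]
  simp only [eq_comm]

/-- A factor of a non-zero homogeneous polynomial is homogeneous: the scaled product is a monomial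
in `t`, hence so is each scaled factor, as degree and trailing degree are additive. -/
theorem isHomogeneous_of_mul {p q : Poly} {d : ℕ} (h : (p * q).IsHomogeneous d)
    (h0 : p * q ≠ 0) : ∃ n, p.IsHomogeneous n := by
  have hp : scale p ≠ 0 := (map_ne_zero_iff scale scale_injective).2 (left_ne_zero_of_mul h0)
  have hq : scale q ≠ 0 := (map_ne_zero_iff scale scale_injective).2 (right_ne_zero_of_mul h0)
  have h1 : scale p * scale q = Polynomial.monomial d (p * q) := by
    rw [← map_mul, scale_of_isHomogeneous h]
  have h2 := Polynomial.natDegree_mul hp hq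
  have h3 := Polynomial.natTrailingDegree_mul hp hq
  rw [h1, Polynomial.natDegree_monomial_eq d h0] at h2
  rw [h1, Polynomial.natTrailingDegree_monomial h0] at h3
  have h4 := (scale p).natTrailingDegree_le_natDegree
  have h5 := (scale q).natTrailingDegree_le_natDegree
  refine ⟨(scale p).natDegree, fun s hs => ?_⟩
  have hc : (scale p).coeff s.degree ≠ 0 := by
    rw [coeff_scale]
    intro hz
    have := congrArg (coeff s) hz
    simp [coeff_homogeneousComponent, hs] at this
  have h6 := Polynomial.le_natDegree_of_ne_zero hc
  have h7 := Polynomial.natTrailingDegree_le_of_ne_zero hc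
  have h8 : Finsupp.weight 1 s = s.degree := by
    rw [Finsupp.degree_eq_weight_one]
    rfl
  omega

/-! ### The degree of a birational map -/

/-- Any two triples without common factor defining the same map divide each other, so the infimum in
the definition of the degree is taken over a single value. -/
theorem degree_eq {F : BirTriple} {d : ℕ} (hF : NoCommonFactor F.fwd)
    (hd : ∀ i, (F.fwd i).IsHomogeneous d) : degree (mk F) = d := by
  have key : ∀ e, (∃ G : BirTriple, mk G = mk F ∧ NoCommonFactor G.fwd ∧
      ∀ i, (G.fwd i).IsHomogeneous e) → e = d := by
    rintro e ⟨G, hGF, hG, he⟩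
    have hp := mk_eq_mk.1 hGF
    obtain ⟨i, hi⟩ := F.fwd_ne_zero
    have h1 := dvd_of_proportional hF hp i
    have h2 := dvd_of_proportional hG hp.symm i
    have hi' : G.fwd i ≠ 0 := fun h => hi (zero_dvd_iff.1 (h ▸ h2))
    have h3 := totalDegree_le_of_dvd_of_isDomain h1 hi'
    have h4 := totalDegree_le_of_dvd_of_isDomain h2 hi
    rw [(hd i).totalDegree hi, (he i).totalDegree hi'] at h3 h4
    omega
  have hmem : d ∈ {e : ℕ | ∃ G : BirTriple, mk G = mk F ∧ NoCommonFactor G.fwd ∧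
      ∀ i, (G.fwd i).IsHomogeneous e} := ⟨F, rfl, hF, hd⟩
  exact key _ (Nat.sInf_mem ⟨d, hmem⟩)

theorem BirTriple.not_isHomogeneous_zero (F : BirTriple) : ¬ ∀ i, (F.fwd i).IsHomogeneous 0 := by
  intro h
  obtain ⟨e, he, hE⟩ := F.bwd_fwd
  obtain ⟨d, hd⟩ := F.bwd_hom
  have h1 : (e * X 0).IsHomogeneous 0 := by
    rw [← hE 0]
    have := (hd 0).aeval F.fwd h
    rwa [zero_mul] at this
  have h2 := h1.totalDegree (mul_ne_zero he (X_ne_zero 0))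
  rw [totalDegree_mul_of_isDomain he (X_ne_zero 0), totalDegree_X] at h2
  omega

/-- A non-constant common factor of a triple can be divided out, which lowers its degree. -/
theorem exists_smaller_triple (F : BirTriple) {d : ℕ} (hd : ∀ i, (F.fwd i).IsHomogeneous d)
    {q : Poly} (hq : ∀ i, q ∣ F.fwd i) (hu : ¬ IsUnit q) :
    ∃ (G : BirTriple) (e : ℕ), mk G = mk F ∧ (∀ i, (G.fwd i).IsHomogeneous e) ∧ e < d := by
  choose G hG using hq
  obtain ⟨i, hi⟩ := F.fwd_ne_zero
  have hqG : q * G i ≠ 0 := by rwa [← hG i]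
  have hq0 := left_ne_zero_of_mul hqG
  obtain ⟨n, hn⟩ := isHomogeneous_of_mul (hG i ▸ hd i) hqG
  have hn0 : n ≠ 0 := by
    rintro rfl
    apply hu
    obtain ⟨c, rfl⟩ : ∃ c, q = C c := ⟨_, totalDegree_eq_zero_iff_eq_C.1 (hn.totalDegree hq0)⟩
    exact (isUnit_iff_ne_zero.2 fun h => hq0 (by rw [h, C_0])).map C
  have hhom : ∀ j, (G j).IsHomogeneous (d - n) := by
    intro j
    by_cases hj : G j = 0
    · rw [hj]
      exact isHomogeneous_zero _ _ _
    have hj' : G j * q ≠ 0 := mul_ne_zero hj hq0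
    obtain ⟨m, hm⟩ := isHomogeneous_of_mul (by rw [mul_comm, ← hG j]; exact hd j) hj'
    have := (hm.mul hn).inj_right (by rw [mul_comm (G j), ← hG j]; exact hd j) hj'
    rwa [show d - n = m by omega]
  have hnd : n ≤ d := by
    rw [← hn.totalDegree hq0, ← (hd i).totalDegree hi]
    exact totalDegree_le_of_dvd_of_isDomain ⟨_, hG i⟩ hi
  have hFG : F.fwd = fun j => q * G j := funext hG
  refine ⟨⟨G, F.bwd, ⟨_, hhom⟩, F.bwd_hom, ?_, ?_⟩, d - n, ?_, hhom, by omega⟩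
  · obtain ⟨h, h0, hh⟩ := F.bwd_fwd
    obtain ⟨e, he⟩ := F.bwd_hom
    have h1 : ∀ j, h * X j = q ^ e * comp F.bwd G j := fun j => by
      rw [← hh j]
      simp only [comp]
      rw [hFG, bind_mul (he j)]
    obtain ⟨h', rfl⟩ := dvd_of_forall_dvd_mul noCommonFactor_X (q ^ e) h fun j => ⟨_, h1 j⟩
    refine ⟨h', right_ne_zero_of_mul h0, fun j => ?_⟩
    apply mul_left_cancel₀ (pow_ne_zero e hq0)
    rw [← h1 j, mul_assoc]
  · obtain ⟨h, h0, hh⟩ := F.fwd_bwd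
    have h1 : ∀ j, h * X j = bind₁ F.bwd q * comp G F.bwd j := fun j => by
      rw [← hh j]
      simp only [comp, hG j, map_mul]
    obtain ⟨h', rfl⟩ := dvd_of_forall_dvd_mul noCommonFactor_X _ h fun j => ⟨_, h1 j⟩
    refine ⟨h', right_ne_zero_of_mul h0, fun j => ?_⟩
    apply mul_left_cancel₀ (left_ne_zero_of_mul h0)
    rw [← h1 j, mul_assoc]
  · exact mk_eq_mk.2 (proportional_of_mul q hG).symm

theorem exists_reduced_triple (d : ℕ) : ∀ F : BirTriple, (∀ i, (F.fwd i).IsHomogeneous d) →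
    ∃ (G : BirTriple) (e : ℕ), mk G = mk F ∧ NoCommonFactor G.fwd ∧
      (∀ i, (G.fwd i).IsHomogeneous e) ∧ e ≤ d := by
  induction d using Nat.strong_induction_on with
  | _ d ih =>
    intro F hd
    by_cases hF : NoCommonFactor F.fwd
    · exact ⟨F, d, rfl, hF, hd, le_rfl⟩
    · simp only [NoCommonFactor, not_forall] at hF
      obtain ⟨q, hq, hu⟩ := hF
      obtain ⟨F', e, hF', he, hlt⟩ := exists_smaller_triple F hd hq hu
      obtain ⟨G, e', h1, h2, h3, h4⟩ := ih e hlt F' he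
      exact ⟨G, e', h1.trans hF', h2, h3, h4.trans hlt.le⟩

theorem degree_le {F : BirTriple} {d : ℕ} (hd : ∀ i, (F.fwd i).IsHomogeneous d) :
    degree (mk F) ≤ d := by
  obtain ⟨G, e, hGF, hG, he, hle⟩ := exists_reduced_triple d F hd
  rw [← hGF, degree_eq hG he]
  exact hle

theorem exists_triple_degree (f : Cremona) :
    ∃ F : BirTriple, mk F = f ∧ ∀ i, (F.fwd i).IsHomogeneous (degree f) := by
  obtain ⟨F, rfl⟩ : ∃ F, mk F = f := Quotient.exists_rep f
  obtain ⟨d, hd⟩ := F.fwd_hom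
  obtain ⟨G, e, hGF, hG, he, -⟩ := exists_reduced_triple d F hd
  refine ⟨G, hGF, ?_⟩
  rwa [← hGF, degree_eq hG he]

theorem one_le_degree (f : Cremona) : 1 ≤ degree f := by
  obtain ⟨F, -, hF⟩ := exists_triple_degree f
  by_contra! h
  rw [Nat.lt_one_iff.1 h] at hF
  exact BirTriple.not_isHomogeneous_zero F hF

theorem degree_mul_le (f g : Cremona) : degree (f * g) ≤ degree f * degree g := by
  obtain ⟨F, hF, hf⟩ := exists_triple_degree f
  obtain ⟨G, hG, hg⟩ := exists_triple_degree g
  have h : degree (mk (F.mul G)) ≤ degree g * degree f :=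
    degree_le fun i => (hf i).aeval G.fwd hg
  have hm : mk (F.mul G) = f * g := by
    rw [← hF, ← hG]
    rfl
  rwa [hm, mul_comm] at h

/-! ### Dynamical degrees -/

/-- If `deg fⁿ` stays within constant factors of `lⁿ`, the dynamical degree is `l`. -/
theorem hasDynamicalDegree_of_bounds {f : Cremona} {l c : ℝ} (hl : 0 < l) (hc : 0 < c)
    (h1 : ∀ n, l ^ n ≤ c * degree (f ^ n)) (h2 : ∀ n, (degree (f ^ n) : ℝ) ≤ c * l ^ n) :
    HasDynamicalDegree f l := by
  have hinv : Tendsto (fun n : ℕ => (1 : ℝ) / (n : ℝ)) atTop (𝓝 0) :=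
    tendsto_one_div_atTop_nhds_zero_nat
  have hroot : ∀ b : ℝ, 0 < b →
      Tendsto (fun n : ℕ => b ^ ((1 : ℝ) / (n : ℝ)) * l) atTop (𝓝 l) := by
    intro b hb
    have := (((Real.continuous_const_rpow hb.ne').tendsto 0).comp hinv).mul_const l
    simpa using this
  have hpow : ∀ (b : ℝ), 0 < b → ∀ n : ℕ, 1 ≤ n →
      (b * l ^ n) ^ ((1 : ℝ) / (n : ℝ)) = b ^ ((1 : ℝ) / (n : ℝ)) * l := by
    intro b hb n hn
    rw [Real.mul_rpow hb.le (pow_nonneg hl.le n), one_div,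
      Real.pow_rpow_inv_natCast hl.le (by omega)]
  refine tendsto_of_tendsto_of_tendsto_of_le_of_le' (hroot c⁻¹ (inv_pos.2 hc)) (hroot c hc) ?_ ?_
  · filter_upwards [eventually_ge_atTop 1] with n hn
    rw [← hpow _ (inv_pos.2 hc) n hn]
    have : c⁻¹ * l ^ n ≤ degree (f ^ n) := by
      rw [inv_mul_le_iff₀ hc]
      exact h1 n
    exact Real.rpow_le_rpow (by positivity) this (by positivity)
  · filter_upwards [eventually_ge_atTop 1] with n hn
    rw [← hpow c hc n hn]
    exact Real.rpow_le_rpow (by positivity) (h2 n) (by positivity)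

/-- Conjugation changes the degrees of the iterates by a bounded factor only. -/
theorem hasDynamicalDegree_of_degree_pow {f g : Cremona} {d : ℕ} (hd : 0 < d)
    (h : ∀ n, degree (f ^ n) = d ^ n) : HasDynamicalDegree (g * f * g⁻¹) d := by
  have hc : (0 : ℝ) < degree g * degree g⁻¹ := by
    exact_mod_cast Nat.mul_pos (one_le_degree g) (one_le_degree g⁻¹)
  refine hasDynamicalDegree_of_bounds (c := degree g * degree g⁻¹) (by exact_mod_cast hd) hc
    (fun n => ?_) fun n => ?_
  · have h1 : f ^ n = g⁻¹ * (g * f * g⁻¹) ^ n * g := by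
      rw [conj_pow]
      group
    have h2 := (degree_mul_le (g⁻¹ * (g * f * g⁻¹) ^ n) g).trans
      (Nat.mul_le_mul_right _ (degree_mul_le _ _))
    rw [← h1, h] at h2
    have h3 : ((d ^ n : ℕ) : ℝ) ≤
        ((degree g⁻¹ * degree ((g * f * g⁻¹) ^ n) * degree g : ℕ) : ℝ) := by exact_mod_cast h2
    push_cast at h3
    linarith
  · have h2 := (degree_mul_le (g * f ^ n) g⁻¹).trans
      (Nat.mul_le_mul_right _ (degree_mul_le _ _))
    rw [← conj_pow, h] at h2
    have h3 : ((degree ((g * f * g⁻¹) ^ n) : ℕ) : ℝ) ≤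
        ((degree g * d ^ n * degree g⁻¹ : ℕ) : ℝ) := by exact_mod_cast h2
    push_cast at h3
    linarith

theorem hasDynamicalDegree_of_isOfFinOrder {f : Cremona} (hf : IsOfFinOrder f) :
    HasDynamicalDegree f 1 := by
  have hfin : (Set.range fun n : ℕ => f ^ n).Finite := by
    have := hf.finite_powers
    rwa [Submonoid.coe_powers] at this
  obtain ⟨c, hc⟩ := (hfin.image degree).bddAbove
  have hb : ∀ n, degree (f ^ n) ≤ c := fun n => hc ⟨_, ⟨n, rfl⟩, rfl⟩
  have hc1 : 1 ≤ c := (one_le_degree _).trans (hb 0)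
  have hc1' : (1 : ℝ) ≤ c := by exact_mod_cast hc1
  refine hasDynamicalDegree_of_bounds (c := c) one_pos (by linarith) (fun n => ?_) fun n => ?_
  · have h1 : (1 : ℝ) ≤ degree (f ^ n) := by exact_mod_cast one_le_degree _
    rw [one_pow]
    nlinarith
  · rw [one_pow, mul_one]
    exact_mod_cast hb n

/-! ### Triples defining `ψ ∘ f` and `A ∘ f` -/

/-- The triple `F` of homogeneous polynomials of degree `d` defines the birational map `f`. -/
def Represents (F : Fin 3 → Poly) (d : ℕ) (f : Cremona) : Prop :=
  ∃ T : BirTriple, mk T = f ∧ T.fwd = F ∧ ∀ i, (F i).IsHomogeneous d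

theorem Represents.mul {F G : Fin 3 → Poly} {d e : ℕ} {f g : Cremona} (hF : Represents F d f)
    (hG : Represents G e g) : Represents (comp F G) (e * d) (f * g) := by
  obtain ⟨T, rfl, rfl, hd⟩ := hF
  obtain ⟨U, rfl, rfl, he⟩ := hG
  exact ⟨T.mul U, rfl, rfl, fun i => (hd i).aeval U.fwd he⟩

theorem Represents.degree_eq {F : Fin 3 → Poly} {d : ℕ} {f : Cremona} (hF : Represents F d f)
    (h : NoCommonFactor F) : degree f = d := by
  obtain ⟨T, rfl, rfl, hd⟩ := hF
  exact Cremona.degree_eq h hd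

theorem represents_one : Represents X 1 1 :=
  ⟨BirTriple.one, rfl, rfl, fun i => isHomogeneous_X ℂ i⟩

theorem represents_thetaE (M : SL(2, ℤ)) : Represents (linearTriple M) 1 (thetaE M) :=
  ⟨_, rfl, rfl, linearTriple_hom M⟩

/-- The action of `ψ` (for `c = 1`) and of `ψ⁻¹` (for `c = -1`) on triples of polynomials: with
`ℓ = F 0 - μ F 1`, the triple `F` becomes `ℓ ^ (k - 1) F + c (F 2) ^ k (μ, 1, 0)`. -/
noncomputable def twist (k : ℕ) (μ c : ℂ) (F : Fin 3 → Poly) : Fin 3 → Poly :=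
  fun i => (F 0 - C μ * F 1) ^ (k - 1) * F i + C c * F 2 ^ k * C (![μ, 1, 0] i)

theorem twist_eq_comp {k : ℕ} (hk : 0 < k) (μ c : ℂ) (F : Fin 3 → Poly) :
    twist k μ c F =
      comp (comp (comp (shearTriple μ) (psiTriple k c)) (shearTriple (-μ))) F := by
  obtain ⟨n, rfl⟩ : ∃ n, k = n + 1 := ⟨k - 1, by omega⟩
  funext i
  fin_cases i <;> simp [twist, comp, shearTriple, psiTriple] <;> ring

theorem Represents.psi_mul {k : ℕ} (hk : 0 < k) (μ : ℂ) {F : Fin 3 → Poly} {d : ℕ} {f : Cremona}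
    (hF : Represents F d f) : Represents (twist k μ 1 F) (d * k) (psi k hk μ * f) := by
  have h1 : Represents (shearTriple μ) 1 (shear μ) := ⟨_, rfl, rfl, shearTriple_hom μ⟩
  have h2 : Represents (psiTriple k 1) k (psi' k hk) := ⟨_, rfl, rfl, psiTriple_hom hk 1⟩
  have h3 : Represents (shearTriple (-μ)) 1 (shear μ)⁻¹ := ⟨_, rfl, rfl, shearTriple_hom (-μ)⟩
  have := ((h1.mul h2).mul h3).mul hF
  rw [← twist_eq_comp hk] at this
  simpa [psi] using this

theorem Represents.psi_inv_mul {k : ℕ} (hk : 0 < k) (μ : ℂ) {F : Fin 3 → Poly} {d : ℕ}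
    {f : Cremona} (hF : Represents F d f) :
    Represents (twist k μ (-1) F) (d * k) ((psi k hk μ)⁻¹ * f) := by
  have h1 : Represents (shearTriple μ) 1 (shear μ) := ⟨_, rfl, rfl, shearTriple_hom μ⟩
  have h2 : Represents (psiTriple k (-1)) k (psi' k hk)⁻¹ :=
    ⟨_, rfl, rfl, psiTriple_hom hk (-1)⟩
  have h3 : Represents (shearTriple (-μ)) 1 (shear μ)⁻¹ := ⟨_, rfl, rfl, shearTriple_hom (-μ)⟩
  have := ((h1.mul h2).mul h3).mul hF
  rw [← twist_eq_comp hk] at this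
  simpa [psi, mul_assoc] using this

theorem Represents.thetaE_mul (M : SL(2, ℤ)) {F : Fin 3 → Poly} {d : ℕ} {f : Cremona}
    (hF : Represents F d f) : Represents (comp (linearTriple M) F) d (thetaE M * f) := by
  simpa using (represents_thetaE M).mul hF

/-! ### Curves on the line at infinity and the base point of `ψ` -/

/-- The linear form `ℓ = x - μ y` evaluated at the image of the triple `F` under the matrix `A`.
It vanishes where the transform of `F` lies on the line that `ψ` contracts. -/
noncomputable def lineForm (μ : ℂ) (A : SL(2, ℤ)) (F : Fin 3 → Poly) : Poly :=
  C ((A 0 0 : ℂ) - μ * (A 1 0 : ℂ)) * F 0 + C ((A 0 1 : ℂ) - μ * (A 1 1 : ℂ)) * F 1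

theorem lineForm_one (μ : ℂ) (F : Fin 3 → Poly) : lineForm μ 1 F = F 0 - C μ * F 1 := by
  simp [lineForm]
  ring

theorem lineForm_comp_linearTriple (μ : ℂ) (A B : SL(2, ℤ)) (F : Fin 3 → Poly) :
    lineForm μ A (comp (linearTriple B) F) = lineForm μ (A * B) F := by
  simp [lineForm, comp, linearTriple, Matrix.mul_apply, Fin.sum_univ_two]
  ring

/-- The prime factors `q` of `F 2` are the curves which `F` maps into the line `z = 0`. The condition
says that no `A ∈ G` moves the image of such a curve into the point `(μ : 1 : 0)`: the linear form
`x - μ y` of `A ∘ F` is non-zero modulo `q`. -/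
def Avoids (μ : ℂ) (G : Set SL(2, ℤ)) (F : Fin 3 → Poly) : Prop :=
  ∀ q : Poly, Prime q → q ∣ F 2 → ∀ A ∈ G, ¬ q ∣ lineForm μ A F

theorem avoids_X (μ : ℂ) : Avoids μ Set.univ X := by
  intro q hq hqz A _ hdvd
  -- `q` is an associate of `z`, which does not divide a non-zero linear form in `x` and `y`
  have hz : (X 2 : Poly) ∣ lineForm μ A X :=
    ((hq.irreducible.associated_of_dvd X_prime.irreducible hqz).symm.dvd).trans hdvd
  obtain ⟨p, hp⟩ := hz
  have hval : ∀ a b : ℂ, eval ![a, b, 0] (lineForm μ A X) = 0 := fun a b => by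
    rw [hp, map_mul, eval_X]
    simp
  have h1 := hval 1 0
  have h2 := hval 0 1
  simp [lineForm] at h1 h2
  have hdet : (A 0 0 : ℂ) * A 1 1 - A 0 1 * A 1 0 = 1 := by
    have := A.det_coe
    rw [Matrix.det_fin_two] at this
    exact_mod_cast this
  have : (1 : ℂ) = 0 := by
    rw [← hdet]
    linear_combination (A 1 1 : ℂ) * h1 - (A 1 0 : ℂ) * h2
  exact one_ne_zero this

theorem Avoids.mono {μ : ℂ} {G G' : Set SL(2, ℤ)} {F : Fin 3 → Poly} (h : Avoids μ G F)
    (hG : G' ⊆ G) : Avoids μ G' F :=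
  fun q hq hqF A hA => h q hq hqF A (hG hA)

theorem Avoids.linear {μ : ℂ} {G : Set SL(2, ℤ)} {F : Fin 3 → Poly} (h : Avoids μ G F)
    (B : SL(2, ℤ)) : Avoids μ {A | A * B ∈ G} (comp (linearTriple B) F) := by
  intro q hq hqF A hA
  rw [lineForm_comp_linearTriple]
  refine h q hq ?_ _ hA
  simpa [comp, linearTriple] using hqF

/-- The hypothesis says that `A` maps the vector `(μ, 1)` into the line `x = μ y`. -/
theorem TrivialIsotropy.eq_of_lineForm_eq_zero {μ : ℂ} (hμ : TrivialIsotropy μ) {A : SL(2, ℤ)}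
    (h : ((A 0 0 : ℂ) - μ * (A 1 0 : ℂ)) * μ + ((A 0 1 : ℂ) - μ * (A 1 1 : ℂ)) = 0) :
    A = 1 ∨ A = -1 := by
  have hdet : (A 0 0 : ℂ) * A 1 1 - A 0 1 * A 1 0 = 1 := by
    have := A.det_coe
    rw [Matrix.det_fin_two] at this
    exact_mod_cast this
  refine hμ A ⟨(A 1 0 : ℂ) * μ + A 1 1, ?_, ?_⟩
  · intro h0
    -- the vector `(μ, 1)` would be in the kernel of the invertible matrix `A`
    have h1 : (A 0 0 : ℂ) * μ + A 0 1 = 0 := by linear_combination h + μ * h0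
    have : (1 : ℂ) = 0 := by
      rw [← hdet]
      linear_combination (A 0 0 : ℂ) * h0 - (A 1 0 : ℂ) * h1
    exact one_ne_zero this
  · funext i
    fin_cases i
    · simp [Matrix.mulVec, dotProduct, Fin.sum_univ_two]
      linear_combination h
    · simp [Matrix.mulVec, dotProduct, Fin.sum_univ_two]

/-- The curves mapped into `z = 0` by `ψ ∘ F` are those mapped there by `F`, whose images do not
change, and those mapped by `F` into the line that `ψ` contracts, whose image becomes the point
`(μ : 1 : 0)`. -/
theorem Avoids.twist {k : ℕ} (hk : 2 ≤ k) {μ c : ℂ} (hc : c ≠ 0) (hμ : TrivialIsotropy μ)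
    {G : Set SL(2, ℤ)} {F : Fin 3 → Poly} (h : Avoids μ G F) (h1 : 1 ∈ G) :
    Avoids μ {A ∈ G | A ≠ 1 ∧ A ≠ -1} (twist k μ c F) := by
  have hform : ∀ A, lineForm μ A (Cremona.twist k μ c F) =
      lineForm μ 1 F ^ (k - 1) * lineForm μ A F
      + C (c * (((A 0 0 : ℂ) - μ * (A 1 0 : ℂ)) * μ + ((A 0 1 : ℂ) - μ * (A 1 1 : ℂ)))) * F 2 ^ k := by
    intro A
    rw [lineForm_one]
    simp [lineForm, Cremona.twist]
    ring
  rintro q hq hqF A ⟨hA, hA1⟩ hdvd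
  rw [hform] at hdvd
  have hq2 : q ∣ lineForm μ 1 F ^ (k - 1) * F 2 := by
    rw [lineForm_one]
    simpa [Cremona.twist] using hqF
  by_cases hz : q ∣ F 2
  · -- modulo `q` the triple is multiplied by a power of `ℓ`, which is not divisible by `q`
    rw [dvd_add_left ((dvd_pow hz (by omega)).mul_left _)] at hdvd
    rcases hq.dvd_or_dvd hdvd with h2 | h2
    · exact h q hq hz 1 h1 (hq.dvd_of_dvd_pow h2)
    · exact h q hq hz A hA h2
  · -- modulo `q` the triple becomes a multiple of `(μ, 1, 0)`
    have hl : q ∣ lineForm μ 1 F ^ (k - 1) := (hq.dvd_or_dvd hq2).resolve_right hz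
    rw [dvd_add_right (hl.mul_right _)] at hdvd
    have hC := (hq.dvd_or_dvd hdvd).resolve_right fun h2 => hz (hq.dvd_of_dvd_pow h2)
    have hne : c * (((A 0 0 : ℂ) - μ * (A 1 0 : ℂ)) * μ + ((A 0 1 : ℂ) - μ * (A 1 1 : ℂ))) ≠ 0 :=
      mul_ne_zero hc fun h0 => (hμ.eq_of_lineForm_eq_zero h0).elim hA1.1 hA1.2
    exact hq.not_isUnit (isUnit_of_dvd_unit hC ((isUnit_iff_ne_zero.2 hne).map C))

theorem Avoids.noCommonFactor {μ : ℂ} {G : Set SL(2, ℤ)} {F : Fin 3 → Poly} (h : Avoids μ G F)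
    (h1 : 1 ∈ G) : NoCommonFactor F := by
  have key : ∀ p : Poly, Prime p → ¬ ∀ i, p ∣ F i := fun p hp hdvd => by
    refine h p hp (hdvd 2) 1 h1 ?_
    rw [lineForm_one]
    exact dvd_sub (hdvd 0) ((hdvd 1).mul_left _)
  intro q hq
  by_contra hu
  by_cases h0 : q = 0
  · subst h0
    exact key (X 0) X_prime fun i => (zero_dvd_iff.1 (hq i)).symm ▸ dvd_zero _
  · obtain ⟨p, hp, hpq⟩ := WfDvdMonoid.exists_irreducible_factor hu h0
    exact key p hp.prime fun i => hpq.trans (hq i)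

/-! ### Alternating products in `SL(2, ℤ)` -/

/-- Matrices both of whose rows lie, up to sign, in the quadrant `x ≥ 0 ≥ y`, the matrices `S` and
`-S` being excluded. -/
def staircase : Set SL(2, ℤ) :=
  {M | M 0 0 * M 0 1 ≤ 0 ∧ M 1 0 * M 1 1 ≤ 0 ∧ ¬ (M 0 0 = 0 ∧ M 1 1 = 0)}

/-- `b` is one of the exponents `1` and `-1`. -/
def IsSign (b : ℤ) : Prop := b = 1 ∨ b = -1

theorem coe_matS : (matS : Matrix (Fin 2) (Fin 2) ℤ) = !![0, 1; -1, 0] := rfl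

theorem coe_matR_mul_matS :
    ((matR * matS : SL(2, ℤ)) : Matrix (Fin 2) (Fin 2) ℤ) = !![-1, 1; -1, 0] := by
  rw [Matrix.SpecialLinearGroup.coe_mul, coe_matS]
  simp [matR]

theorem matS_zpow {b : ℤ} (hb : IsSign b) :
    ((matS ^ b : SL(2, ℤ)) : Matrix (Fin 2) (Fin 2) ℤ) = !![0, b; -b, 0] := by
  rcases hb with rfl | rfl
  · rw [zpow_one, coe_matS]
  · rw [zpow_neg_one, Matrix.SpecialLinearGroup.coe_inv, coe_matS]
    simp [Matrix.adjugate_fin_two]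

theorem matU_zpow {a : ℤ} (ha : IsSign a) :
    (((matR * matS) ^ a : SL(2, ℤ)) : Matrix (Fin 2) (Fin 2) ℤ) = !![-1, 1; -1, 0] ∨
    (((matR * matS) ^ a : SL(2, ℤ)) : Matrix (Fin 2) (Fin 2) ℤ) = !![0, -1; 1, -1] := by
  rcases ha with rfl | rfl
  · left
    rw [zpow_one, coe_matR_mul_matS]
  · right
    rw [zpow_neg_one, Matrix.SpecialLinearGroup.coe_inv, coe_matR_mul_matS]
    simp [Matrix.adjugate_fin_two]

theorem one_mem_staircase : (1 : SL(2, ℤ)) ∈ staircase := by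
  simp [staircase]

theorem matU_mem_staircase {a : ℤ} (ha : IsSign a) :
    (matR * matS) ^ a ∈ {A ∈ staircase | A ≠ 1 ∧ A ≠ -1} := by
  have h1 : ∀ A : SL(2, ℤ), A 0 0 = 0 ∨ A 1 1 = 0 → A ≠ 1 ∧ A ≠ -1 := by
    intro A hA
    constructor <;> rintro rfl <;> simp at hA
  rcases matU_zpow ha with h | h
  · exact ⟨by simp [staircase, h], h1 _ (by simp [h])⟩
  · exact ⟨by simp [staircase, h], h1 _ (by simp [h])⟩

theorem matrix_ne {A : SL(2, ℤ)} (hA : A 0 1 ≠ 0 ∨ A 1 0 ≠ 0) : A ≠ 1 ∧ A ≠ -1 := by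
  constructor <;> rintro rfl <;> simp at hA

theorem staircase_mul_matS {A : SL(2, ℤ)} (hA : A ∈ staircase) {b : ℤ} (hb : IsSign b) :
    A * matS ^ b ≠ 1 ∧ A * matS ^ b ≠ -1 := by
  obtain ⟨-, -, h⟩ := hA
  apply matrix_ne
  rw [Matrix.SpecialLinearGroup.coe_mul, matS_zpow hb]
  rcases hb with rfl | rfl <;> simp [Matrix.mul_apply, Fin.sum_univ_two] <;> tauto

/-- Right multiplication by `S ^ b (RS) ^ a` is, up to sign, a row operation `(x, y) ↦ (x - y, y)`
or `(x, y) ↦ (x, y - x)`, which preserves the quadrants in question. -/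
theorem staircase_mul {A : SL(2, ℤ)} (hA : A ∈ staircase) {a b : ℤ} (ha : IsSign a)
    (hb : IsSign b) : A * (matS ^ b * (matR * matS) ^ a) ∈ {A ∈ staircase | A ≠ 1 ∧ A ≠ -1} := by
  obtain ⟨h1, h2, h⟩ := hA
  have hdet := A.det_coe
  rw [Matrix.det_fin_two] at hdet
  generalize hB : A * (matS ^ b * (matR * matS) ^ a) = B
  have hB' : (B : Matrix (Fin 2) (Fin 2) ℤ) = A * (matS ^ b * (matR * matS) ^ a : SL(2, ℤ)) := by
    rw [← hB, Matrix.SpecialLinearGroup.coe_mul]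
  have h00 := congrFun (congrFun hB' 0) 0
  have h01 := congrFun (congrFun hB' 0) 1
  have h10 := congrFun (congrFun hB' 1) 0
  have h11 := congrFun (congrFun hB' 1) 1
  rw [Matrix.SpecialLinearGroup.coe_mul, matS_zpow hb] at h00 h01 h10 h11
  suffices hs : (B 0 0 * B 0 1 ≤ 0 ∧ B 1 0 * B 1 1 ≤ 0 ∧ ¬ (B 0 0 = 0 ∧ B 1 1 = 0)) ∧
      (B 0 1 ≠ 0 ∨ B 1 0 ≠ 0) from ⟨hs.1, matrix_ne hs.2⟩
  have hpq : A 0 0 = A 0 1 → A 0 0 = 0 ∧ A 0 1 = 0 := by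
    intro e
    rw [e] at h1 ⊢
    have : A 0 1 = 0 := by nlinarith
    exact ⟨this, this⟩
  have hrs : A 1 0 = A 1 1 → A 1 0 = 0 ∧ A 1 1 = 0 := by
    intro e
    rw [e] at h2 ⊢
    have : A 1 1 = 0 := by nlinarith
    exact ⟨this, this⟩
  clear hB hB'
  rcases hb with rfl | rfl <;> rcases matU_zpow ha with hu | hu <;>
    rw [hu] at h00 h01 h10 h11 <;>
    simp [Matrix.mul_apply, Fin.sum_univ_two] at h00 h01 h10 h11 <;>
    rw [h00, h01, h10, h11] <;>
    refine ⟨⟨by nlinarith [sq_nonneg (A 0 0), sq_nonneg (A 0 1)],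
      by nlinarith [sq_nonneg (A 1 0), sq_nonneg (A 1 1)], ?_⟩, ?_⟩ <;>
    grind

/-- One block `S ^ b ψ (RS) ^ a ψ⁻¹` preserves the condition relative to `staircase`. -/
theorem Avoids.block {k : ℕ} (hk : 2 ≤ k) {μ : ℂ} (hμ : TrivialIsotropy μ) {F : Fin 3 → Poly}
    (h : Avoids μ staircase F) {a b : ℤ} (ha : IsSign a) (hb : IsSign b) :
    Avoids μ staircase (comp (linearTriple (matS ^ b)) (Cremona.twist k μ 1
      (comp (linearTriple ((matR * matS) ^ a)) (Cremona.twist k μ (-1) F)))) := by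
  have h1 := (h.twist hk (neg_ne_zero.2 one_ne_zero) hμ one_mem_staircase).linear
    ((matR * matS) ^ a)
  have h2 := (h1.twist hk one_ne_zero hμ
    (by simpa using matU_mem_staircase ha)).linear (matS ^ b)
  refine h2.mono fun A hA => ⟨?_, staircase_mul_matS hA hb⟩
  have := staircase_mul hA ha hb
  rwa [← mul_assoc] at this

/-! ### Degrees of products of blocks -/

/-- The product `∏ s ^ b u ^ a` over a list of pairs `(b, a)`. -/
def blockProd {G : Type*} [Group G] (s u : G) (l : List (ℤ × ℤ)) : G :=
  (l.map fun p => s ^ p.1 * u ^ p.2).prod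

/-- All exponents in a list of pairs are `1` or `-1`. -/
def IsSigned (l : List (ℤ × ℤ)) : Prop := ∀ p ∈ l, IsSign p.1 ∧ IsSign p.2

theorem map_blockProd {G H : Type*} [Group G] [Group H] (f : G →* H) (s u : G)
    (l : List (ℤ × ℤ)) : f (blockProd s u l) = blockProd (f s) (f u) l := by
  simp [blockProd, map_list_prod, Function.comp_def]

theorem exists_represents_blockProd {k : ℕ} (hk : 0 < k) (hk2 : 2 ≤ k) {μ : ℂ}
    (hμ : TrivialIsotropy μ) (l : List (ℤ × ℤ)) (hl : IsSigned l) :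
    ∃ F : Fin 3 → Poly, Avoids μ staircase F ∧ Represents F (k ^ (2 * l.length))
      (blockProd (thetaE matS) (psi k hk μ * thetaE (matR * matS) * (psi k hk μ)⁻¹) l) := by
  induction l with
  | nil =>
    exact ⟨X, (avoids_X μ).mono (Set.subset_univ _), by simpa [blockProd] using represents_one⟩
  | cons p l ih =>
    obtain ⟨F, hF, hR⟩ := ih fun p hp => hl p (List.mem_cons_of_mem _ hp)
    obtain ⟨hb, ha⟩ := hl p List.mem_cons_self
    refine ⟨_, hF.block hk2 hμ ha hb, ?_⟩
    have := (((hR.psi_inv_mul hk μ).thetaE_mul ((matR * matS) ^ p.2)).psi_mul hk μ).thetaE_mul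
      (matS ^ p.1)
    have hdeg : k ^ (2 * l.length) * k * k = k ^ (2 * (p :: l).length) := by
      rw [List.length_cons]
      ring
    rw [hdeg] at this
    convert this using 1
    rw [blockProd, List.map_cons, List.prod_cons, conj_zpow, map_zpow, map_zpow]
    simp only [mul_assoc, blockProd]

/-- Composing the triples of the factors produces no common factor, so degrees multiply. -/
theorem degree_blockProd {k : ℕ} (hk : 0 < k) (hk2 : 2 ≤ k) {μ : ℂ}
    (hμ : TrivialIsotropy μ) (l : List (ℤ × ℤ)) (hl : IsSigned l) :
    degree (blockProd (thetaE matS) (psi k hk μ * thetaE (matR * matS) * (psi k hk μ)⁻¹) l) =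
      k ^ (2 * l.length) := by
  obtain ⟨F, hF, hR⟩ := exists_represents_blockProd hk hk2 hμ l hl
  exact hR.degree_eq (hF.noCommonFactor one_mem_staircase)

/-! ### Groups generated by a pair satisfying the modular relations -/

section NormalForm

variable {G : Type*} [Group G] {s u : G}

theorem blockProd_nil : blockProd s u [] = 1 := rfl

theorem blockProd_cons (b a : ℤ) (l : List (ℤ × ℤ)) :
    blockProd s u ((b, a) :: l) = s ^ b * u ^ a * blockProd s u l := by
  simp [blockProd]

theorem blockProd_append (l l' : List (ℤ × ℤ)) :
    blockProd s u (l ++ l') = blockProd s u l * blockProd s u l' := by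
  simp [blockProd]

/-- The relations `s⁴ = u³ = 1` and `s² u = u s²`, which present `SL(2, ℤ)`. -/
structure ModularPair (s u : G) : Prop where
  pow_four : s ^ 4 = 1
  pow_three : u ^ 3 = 1
  comm : Commute (s ^ 2) u

theorem zpow_eq_sign_or_one (hu : u ^ 3 = 1) (i : ℤ) :
    (3 ∣ i ∧ u ^ i = 1) ∨ ∃ a, IsSign a ∧ u ^ i = u ^ a := by
  have hu' : u ^ (3 : ℤ) = 1 := by exact_mod_cast hu
  have h : ∀ r q : ℤ, i = r + 3 * q → u ^ i = u ^ r := by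
    rintro r q rfl
    rw [zpow_add, zpow_mul, hu', one_zpow, mul_one]
  rcases (by omega : i % 3 = 0 ∨ i % 3 = 1 ∨ i % 3 = 2) with h0 | h0 | h0
  · left
    exact ⟨Int.dvd_of_emod_eq_zero h0, by rw [h 0 (i / 3) (by omega), zpow_zero]⟩
  · exact Or.inr ⟨1, Or.inl rfl, h 1 (i / 3) (by omega)⟩
  · exact Or.inr ⟨-1, Or.inr rfl, h (-1) (i / 3 + 1) (by omega)⟩

theorem exists_sign_zpow_odd (hs : s ^ 4 = 1) (e : ℤ) :
    ∃ b, IsSign b ∧ s ^ (2 * e + 1) = s ^ b := by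
  have hs' : s ^ (4 : ℤ) = 1 := by exact_mod_cast hs
  have h : ∀ r q : ℤ, 2 * e + 1 = r + 4 * q → s ^ (2 * e + 1) = s ^ r := by
    intro r q hrq
    rw [hrq, zpow_add, zpow_mul, hs', one_zpow, mul_one]
  rcases (by omega : e % 2 = 0 ∨ e % 2 = 1) with h0 | h0
  · exact ⟨1, Or.inl rfl, h 1 (e / 2) (by omega)⟩
  · exact ⟨-1, Or.inr rfl, h (-1) (e / 2 + 1) (by omega)⟩

theorem ModularPair.commute_blockProd (h : ModularPair s u) (e : ℤ) (l : List (ℤ × ℤ)) :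
    Commute (s ^ (2 * e)) (blockProd s u l) := by
  have hu : Commute (s ^ (2 * e)) u := by
    rw [zpow_mul]
    exact Commute.zpow_left (by exact_mod_cast h.comm) e
  induction l with
  | nil => exact Commute.one_right _
  | cons p l ih =>
    rw [blockProd_cons]
    exact (((Commute.refl s).zpow_zpow _ _).mul_right (hu.zpow_right _)).mul_right ih

theorem ModularPair.commute_zpow (h : ModularPair s u) (e i : ℤ) :
    Commute (s ^ (2 * e)) (u ^ i) := by
  rw [zpow_mul]
  exact (Commute.zpow_left (by exact_mod_cast h.comm) e).zpow_right i

theorem exists_zpow_eq (s : G) (j : ℤ) :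
    ∃ e : ℤ, s ^ j = s ^ (2 * e) ∨ s ^ j = s ^ (2 * e + 1) := by
  obtain ⟨e, he | he⟩ := Int.even_or_odd' j
  · exact ⟨e, Or.inl (by rw [he])⟩
  · exact ⟨e, Or.inr (by rw [he])⟩

/-- Every element of the group generated by `s` and `u` is a product of blocks, up to a power of
`u` on the left and a power of `s` on the right. -/
theorem ModularPair.exists_normalForm (h : ModularPair s u) {g : G}
    (hg : g ∈ Subgroup.closure {s, u}) :
    ∃ (i j : ℤ) (l : List (ℤ × ℤ)), IsSigned l ∧ g = u ^ i * blockProd s u l * s ^ j := by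
  -- central even powers of `s` move to the right end
  have hcentral : ∀ (e i : ℤ) (l : List (ℤ × ℤ)) (j : ℤ),
      s ^ (2 * e) * (u ^ i * blockProd s u l * s ^ j) =
      u ^ i * blockProd s u l * s ^ (2 * e + j) := fun e i l j => by
    have hc := (h.commute_zpow e i).mul_right (h.commute_blockProd e l)
    rw [← mul_assoc, hc.eq, zpow_add]
    simp only [mul_assoc]
  have hleft : ∀ (m i j : ℤ) (l : List (ℤ × ℤ)), IsSigned l → ∃ (i' j' : ℤ) (l' : List (ℤ × ℤ)),
      IsSigned l' ∧ s ^ m * (u ^ i * blockProd s u l * s ^ j) =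
        u ^ i' * blockProd s u l' * s ^ j' := by
    intro m i j l hl
    obtain ⟨e, he | he⟩ := exists_zpow_eq s m
    · exact ⟨i, 2 * e + j, l, hl, by rw [he, hcentral]⟩
    rcases zpow_eq_sign_or_one h.pow_three i with ⟨-, hi⟩ | ⟨a, ha, hi⟩
    · cases l with
      | nil => exact ⟨0, m + j, [], hl, by simp [hi, blockProd_nil, zpow_add]⟩
      | cons p l =>
        obtain ⟨e', he'⟩ : ∃ e' : ℤ, s ^ m * s ^ p.1 = s ^ (2 * e') := by
          rcases (hl p List.mem_cons_self).1 with hp | hp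
          · exact ⟨e + 1, by rw [he, hp, ← zpow_add]; ring_nf⟩
          · exact ⟨e, by rw [he, hp, ← zpow_add]; ring_nf⟩
        refine ⟨p.2, 2 * e' + j, l, fun q hq => hl q (List.mem_cons_of_mem _ hq), ?_⟩
        rw [← hcentral, ← he', hi, blockProd_cons]
        simp only [mul_assoc, one_mul]
    · refine ⟨0, 2 * e + j, (1, a) :: l, ?_, ?_⟩
      · intro p hp
        rcases List.mem_cons.1 hp with rfl | hp
        · exact ⟨Or.inl rfl, ha⟩
        · exact hl p hp
      · rw [← hcentral, he, hi, blockProd_cons, zpow_add]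
        simp only [mul_assoc, zpow_zero, one_mul]
  induction hg using Subgroup.closure_induction_left with
  | one => exact ⟨0, 0, [], by simp [IsSigned], by simp [blockProd_nil]⟩
  | mul_left x hx y _ ih =>
    obtain ⟨i, j, l, hl, rfl⟩ := ih
    rcases hx with rfl | rfl
    · simpa only [zpow_one] using hleft 1 i j l hl
    · exact ⟨1 + i, j, l, hl, by rw [zpow_one_add]; simp only [mul_assoc]⟩
  | inv_mul_cancel x hx y _ ih =>
    obtain ⟨i, j, l, hl, rfl⟩ := ih
    rcases hx with rfl | rfl
    · simpa only [zpow_neg_one] using hleft (-1) i j l hl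
    · exact ⟨-1 + i, j, l, hl, by rw [zpow_add, zpow_neg_one]; simp only [mul_assoc]⟩

theorem isConj_mul_comm (x y : G) : IsConj (x * y) (y * x) :=
  isConj_iff.2 ⟨x⁻¹, by group⟩

/-- An even power of `s` can be absorbed into the first block of a non-empty product. -/
theorem ModularPair.exists_absorb (h : ModularPair s u) (e : ℤ) {l : List (ℤ × ℤ)}
    (hl : IsSigned l) (hne : l ≠ []) :
    ∃ l', IsSigned l' ∧ l' ≠ [] ∧ s ^ (2 * e) * blockProd s u l = blockProd s u l' := by
  obtain ⟨p, l, rfl⟩ := List.exists_cons_of_ne_nil hne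
  obtain ⟨b, hb, hbe⟩ : ∃ b, IsSign b ∧ s ^ (2 * e + p.1) = s ^ b := by
    rcases (hl p List.mem_cons_self).1 with hp | hp
    · rw [hp]
      exact exists_sign_zpow_odd h.pow_four e
    · rw [hp, show 2 * e + -1 = 2 * (e - 1) + 1 by ring]
      exact exists_sign_zpow_odd h.pow_four _
  refine ⟨(b, p.2) :: l, ?_, by simp, ?_⟩
  · intro q hq
    rcases List.mem_cons.1 hq with rfl | hq
    · exact ⟨hb, (hl p List.mem_cons_self).2⟩
    · exact hl q (List.mem_cons_of_mem _ hq)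
  · rw [blockProd_cons, blockProd_cons, ← hbe, zpow_add]
    simp only [mul_assoc]

/-- Cyclic reduction: a product of blocks followed by a power of `s` and a power of `u` is conjugate
to a power of `s`, to a central element times a power of `u`, or to a non-empty product of blocks. -/
theorem ModularPair.isConj_of_length (h : ModularPair s u) (n : ℕ) :
    ∀ (e j i : ℤ) (l : List (ℤ × ℤ)), IsSigned l → l.length = n →
      (∃ m : ℤ, IsConj (s ^ (2 * e) * (blockProd s u l * s ^ j * u ^ i)) (s ^ m)) ∨
      (∃ m i' : ℤ, IsConj (s ^ (2 * e) * (blockProd s u l * s ^ j * u ^ i)) (s ^ (2 * m) * u ^ i')) ∨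
      ∃ l', IsSigned l' ∧ l' ≠ [] ∧
        IsConj (s ^ (2 * e) * (blockProd s u l * s ^ j * u ^ i)) (blockProd s u l') := by
  induction n using Nat.strong_induction_on with
  | _ n ih =>
    intro e j i l hl hn
    obtain ⟨c, hc | hc⟩ := exists_zpow_eq s j
    · -- the power of `s` is central
      have hg : s ^ (2 * e) * (blockProd s u l * s ^ j * u ^ i) =
          s ^ (2 * (e + c)) * (blockProd s u l * u ^ i) := by
        rw [hc, ← (h.commute_blockProd c l).eq, mul_add, zpow_add]
        simp only [mul_assoc]
      rw [hg]
      rcases List.eq_nil_or_concat l with rfl | ⟨l, p, rfl⟩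
      · exact Or.inr (Or.inl ⟨e + c, i, by rw [blockProd_nil, one_mul]⟩)
      have hp : IsSign p.1 ∧ IsSign p.2 := hl p (by simp)
      have hl' : IsSigned l := fun q hq => hl q (by simp [hq])
      have hlast : blockProd s u (l.concat p) * u ^ i =
          blockProd s u l * s ^ p.1 * u ^ (p.2 + i) := by
        rw [List.concat_eq_append, blockProd_append, blockProd_cons, blockProd_nil, zpow_add]
        simp only [mul_assoc, one_mul]
      rw [hlast]
      rcases zpow_eq_sign_or_one h.pow_three (p.2 + i) with ⟨-, hi⟩ | ⟨a, ha, hi⟩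
      · have := ih l.length (by simp at hn; omega) (e + c) p.1 0 l hl' rfl
        rwa [zpow_zero, ← hi] at this
      · right; right
        have hl2 : IsSigned (l ++ [(p.1, a)]) := by
          intro q hq
          rcases List.mem_append.1 hq with hq | hq
          · exact hl' q hq
          · rw [List.mem_singleton.1 hq]
            exact ⟨hp.1, ha⟩
        obtain ⟨l', h1, h2, h3⟩ := h.exists_absorb (e + c) hl2 (by simp)
        refine ⟨l', h1, h2, ?_⟩
        rw [← h3, blockProd_append, blockProd_cons, blockProd_nil, hi]
        simp only [mul_assoc, mul_one]
        exact IsConj.refl _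
    · have hg : s ^ (2 * e) * (blockProd s u l * s ^ j * u ^ i) =
          s ^ (2 * (e + c)) * (blockProd s u l * s * u ^ i) := by
        rw [hc, zpow_add, zpow_one, mul_add, zpow_add, ← mul_assoc (blockProd s u l),
          ← (h.commute_blockProd c l).eq]
        simp only [mul_assoc]
      rw [hg]
      rcases zpow_eq_sign_or_one h.pow_three i with ⟨-, hi⟩ | ⟨a, ha, hi⟩
      · -- rotating `s` to the front cancels it against the first block
        have hconj : IsConj (s ^ (2 * (e + c)) * (blockProd s u l * s * u ^ i))
            (s ^ (2 * (e + c) + 1) * blockProd s u l) := by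
          rw [hi, mul_one, ← mul_assoc]
          have := isConj_mul_comm (s ^ (2 * (e + c)) * blockProd s u l) s
          rwa [← mul_assoc s, ← zpow_one_add, add_comm 1] at this
        cases l with
        | nil =>
          left
          exact ⟨_, by simpa only [blockProd_nil, mul_one] using hconj⟩
        | cons p l =>
          obtain ⟨e', he'⟩ : ∃ e' : ℤ, s ^ (2 * (e + c) + 1) * s ^ p.1 = s ^ (2 * e') := by
            rcases (hl p List.mem_cons_self).1 with hp | hp
            · exact ⟨e + c + 1, by rw [hp, ← zpow_add]; ring_nf⟩
            · exact ⟨e + c, by rw [hp, ← zpow_add]; ring_nf⟩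
          have hconj2 : IsConj (s ^ (2 * (e + c) + 1) * blockProd s u (p :: l))
              (s ^ (2 * e') * (blockProd s u l * s ^ (0 : ℤ) * u ^ p.2)) := by
            have hw : s ^ (2 * (e + c) + 1) * blockProd s u (p :: l) =
                u ^ p.2 * (s ^ (2 * e') * blockProd s u l) := by
              rw [blockProd_cons, ← mul_assoc, ← mul_assoc, he', ← mul_assoc,
                (h.commute_zpow e' p.2).eq]
            have := isConj_mul_comm (u ^ p.2) (s ^ (2 * e') * blockProd s u l)
            rwa [← hw, mul_assoc (s ^ (2 * e')), ← mul_one (blockProd s u l),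
              ← zpow_zero s] at this
          have hcc := hconj.trans hconj2
          have := ih l.length (by simp at hn; omega) e' 0 p.2 l
            (fun q hq => hl q (List.mem_cons_of_mem _ hq)) rfl
          rcases this with ⟨m, hm⟩ | ⟨m, i', hm⟩ | ⟨l', h1, h2, hm⟩
          · exact Or.inl ⟨m, hcc.trans hm⟩
          · exact Or.inr (Or.inl ⟨m, i', hcc.trans hm⟩)
          · exact Or.inr (Or.inr ⟨l', h1, h2, hcc.trans hm⟩)
      · right; right
        have hl2 : IsSigned (l ++ [(1, a)]) := by
          intro q hq
          rcases List.mem_append.1 hq with hq | hq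
          · exact hl q hq
          · rw [List.mem_singleton.1 hq]
            exact ⟨Or.inl rfl, ha⟩
        obtain ⟨l', h1, h2, h3⟩ := h.exists_absorb (e + c) hl2 (by simp)
        refine ⟨l', h1, h2, ?_⟩
        rw [← h3, blockProd_append, blockProd_cons, blockProd_nil, hi]
        simp only [mul_assoc, mul_one, zpow_one]
        exact IsConj.refl _

theorem ModularPair.isConj_cases (h : ModularPair s u) {g : G}
    (hg : g ∈ Subgroup.closure {s, u}) :
    (∃ m : ℤ, IsConj g (s ^ m)) ∨ (∃ m i : ℤ, IsConj g (s ^ (2 * m) * u ^ i)) ∨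
      ∃ l, IsSigned l ∧ l ≠ [] ∧ IsConj g (blockProd s u l) := by
  obtain ⟨i, j, l, hl, rfl⟩ := h.exists_normalForm hg
  have hconj : IsConj (u ^ i * blockProd s u l * s ^ j)
      (s ^ (2 * (0 : ℤ)) * (blockProd s u l * s ^ j * u ^ i)) := by
    rw [mul_zero, zpow_zero, one_mul, mul_assoc]
    exact isConj_mul_comm _ _
  rcases h.isConj_of_length l.length 0 j i l hl rfl with ⟨m, hm⟩ | ⟨m, i', hm⟩ | ⟨l', h1, h2, hm⟩
  · exact Or.inl ⟨m, hconj.trans hm⟩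
  · exact Or.inr (Or.inl ⟨m, i', hconj.trans hm⟩)
  · exact Or.inr (Or.inr ⟨l', h1, h2, hconj.trans hm⟩)

end NormalForm

/-! ### The relations of `SL(2, ℤ)` -/

theorem matS_sq : matS ^ 2 = -1 := by
  ext i j
  fin_cases i <;> fin_cases j <;> simp [pow_two, coe_matS, Matrix.mul_apply, Fin.sum_univ_two]

theorem modularPair_mat : ModularPair matS (matR * matS) where
  pow_four := by rw [show 4 = 2 * 2 from rfl, pow_mul, matS_sq, neg_one_sq]
  pow_three := by
    ext i j
    rw [Matrix.SpecialLinearGroup.coe_pow, coe_matR_mul_matS, _root_.pow_three]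
    fin_cases i <;> fin_cases j <;> simp [Matrix.mul_apply, Fin.sum_univ_two]
  comm := by
    rw [matS_sq]
    exact Commute.neg_one_left _

theorem closure_mat : Subgroup.closure {matS, matR * matS} = ⊤ := by
  rw [eq_top_iff, ← SpecialLinearGroup.SL2Z_generators, Subgroup.closure_le]
  have hS : matS ∈ Subgroup.closure {matS, matR * matS} :=
    Subgroup.subset_closure (Set.mem_insert _ _)
  have hU : matR * matS ∈ Subgroup.closure {matS, matR * matS} :=
    Subgroup.subset_closure (Set.mem_insert_of_mem _ rfl)
  rintro M (rfl | rfl)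
  · have : ModularGroup.S = matS⁻¹ := by
      ext i j
      fin_cases i <;> fin_cases j <;>
        simp [ModularGroup.S, Matrix.SpecialLinearGroup.coe_inv, coe_matS, Matrix.adjugate_fin_two]
    rw [this]
    exact inv_mem hS
  · have : ModularGroup.T = matR * matS * matS⁻¹ := by
      rw [mul_inv_cancel_right]
      rfl
    rw [this]
    exact mul_mem hU (inv_mem hS)

theorem blockProd_mat_mem {l : List (ℤ × ℤ)} (hl : IsSigned l) (hne : l ≠ []) :
    blockProd matS (matR * matS) l ∈ {A ∈ staircase | A ≠ 1 ∧ A ≠ -1} := by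
  induction l using List.reverseRecOn with
  | nil => exact absurd rfl hne
  | append_singleton l p ih =>
    have hp := hl p (by simp)
    rw [blockProd_append, blockProd_cons, blockProd_nil, mul_one]
    refine staircase_mul ?_ hp.2 hp.1
    by_cases h0 : l = []
    · rw [h0, blockProd_nil]
      exact one_mem_staircase
    · exact (ih (fun q hq => hl q (by simp [hq])) h0).1

theorem matS_zpow_even (m : ℤ) : (Even m ∧ matS ^ (2 * m) = 1) ∨ matS ^ (2 * m) = -1 := by
  have h2 : matS ^ (2 * m) = (-1 : SL(2, ℤ)) ^ m := by
    rw [zpow_mul, ← matS_sq]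
    rfl
  have h1 : (-1 : SL(2, ℤ)) ^ (2 : ℤ) = 1 := neg_one_sq
  obtain ⟨d, rfl | rfl⟩ := Int.even_or_odd' m
  · exact Or.inl ⟨even_two_mul d, by rw [h2, zpow_mul, h1, one_zpow]⟩
  · exact Or.inr (by rw [h2, zpow_add, zpow_mul, h1, one_zpow, one_mul, zpow_one])

theorem zpow_two_mul_of_even {G : Type*} [Group G] {s : G} (hs : s ^ 4 = 1) {m : ℤ}
    (hm : Even m) : s ^ (2 * m) = 1 := by
  have hs' : s ^ (4 : ℤ) = 1 := by exact_mod_cast hs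
  obtain ⟨d, rfl⟩ := hm
  rw [show 2 * (d + d) = 4 * d by ring, zpow_mul, hs', one_zpow]

theorem neg_one_ne_one : (-1 : SL(2, ℤ)) ≠ 1 := by
  intro h
  have := congrArg (fun M : SL(2, ℤ) => M 0 0) h
  simp at this

/-- A relation between powers of `S` holds for every `s` with `s⁴ = 1`. -/
theorem zpow_eq_one_of_matS {m : ℤ} (h : matS ^ m = 1) {G : Type*} [Group G] {s : G}
    (hs : s ^ 4 = 1) : s ^ m = 1 := by
  obtain ⟨e, rfl | rfl⟩ := Int.even_or_odd' m
  · rcases matS_zpow_even e with ⟨he, -⟩ | he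
    · exact zpow_two_mul_of_even hs he
    · exact absurd (he.symm.trans h) neg_one_ne_one
  · obtain ⟨b, hb, hbe⟩ := exists_sign_zpow_odd modularPair_mat.pow_four e
    have h1 := staircase_mul_matS one_mem_staircase hb
    rw [one_mul, ← hbe] at h1
    exact absurd h h1.1

/-- A relation of the form `S ^ (2 m) (RS) ^ i = 1` holds for every pair satisfying the relations
of the modular group. -/
theorem zpow_mul_eq_one_of_mat {m i : ℤ} (h : matS ^ (2 * m) * (matR * matS) ^ i = 1)
    {G : Type*} [Group G] {s u : G} (hp : ModularPair s u) : s ^ (2 * m) * u ^ i = 1 := by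
  rcases zpow_eq_sign_or_one modularPair_mat.pow_three i with ⟨⟨d, rfl⟩, hi⟩ | ⟨a, ha, hi⟩
  · rw [hi, mul_one] at h
    have hu : u ^ (3 : ℤ) = 1 := by exact_mod_cast hp.pow_three
    rcases matS_zpow_even m with ⟨hm, -⟩ | hm
    · rw [zpow_two_mul_of_even hp.pow_four hm, zpow_mul, hu, one_zpow, one_mul]
    · exact absurd (hm.symm.trans h) neg_one_ne_one
  · obtain ⟨-, h1, h2⟩ := matU_mem_staircase ha
    rw [hi] at h
    rcases matS_zpow_even m with ⟨-, hm⟩ | hm <;> rw [hm] at h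
    · rw [one_mul] at h
      exact absurd h h1
    · rw [neg_one_mul, neg_eq_iff_eq_neg] at h
      exact absurd h h2

/-! ### The presentation of `SL(2, ℤ)` -/

/-- Every pair of elements satisfying the relations of the modular group is the image of `S` and
`RS`. The graph of the morphism is the subgroup generated by the two pairs `(S, s)` and `(RS, u)`;
it projects injectively since, up to conjugation, its elements over `1` are trivial. -/
theorem exists_monoidHom {G : Type*} [Group G] {s u : G} (h : ModularPair s u) :
    ∃ θ : SL(2, ℤ) →* G, θ matS = s ∧ θ (matR * matS) = u := by
  have hp : ModularPair ((matS, s) : SL(2, ℤ) × G) (matR * matS, u) :=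
    ⟨Prod.ext modularPair_mat.pow_four h.pow_four, Prod.ext modularPair_mat.pow_three h.pow_three,
      Prod.ext modularPair_mat.comm h.comm⟩
  let H : Subgroup (SL(2, ℤ) × G) := Subgroup.closure {(matS, s), (matR * matS, u)}
  have hS : (matS, s) ∈ H := Subgroup.subset_closure (Set.mem_insert _ _)
  have hU : (matR * matS, u) ∈ H := Subgroup.subset_closure (Set.mem_insert_of_mem _ rfl)
  let f : H →* SL(2, ℤ) := (MonoidHom.fst SL(2, ℤ) G).comp H.subtype
  have hinj : Function.Injective f := by
    rw [injective_iff_map_eq_one]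
    rintro ⟨g, hg⟩ h1
    replace h1 : g.1 = 1 := h1
    -- an element conjugate to `g` lies over `1` as well
    have hconj : ∀ w : SL(2, ℤ) × G, IsConj g w → w.1 = 1 := fun w hw => by
      have := (MonoidHom.fst SL(2, ℤ) G).map_isConj hw
      rw [MonoidHom.coe_fst, h1] at this
      exact isConj_one_right.1 this
    have hone : ∀ w : SL(2, ℤ) × G, IsConj g w → w.2 = 1 → g = 1 := fun w hw h2 => by
      rw [show w = 1 from Prod.ext (hconj w hw) h2] at hw
      exact isConj_one_left.1 hw
    apply Subtype.ext
    rcases hp.isConj_cases hg with ⟨m, hm⟩ | ⟨m, i, hm⟩ | ⟨l, hl, hne, hm⟩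
    · exact hone _ hm (zpow_eq_one_of_matS (hconj _ hm) h.pow_four)
    · exact hone _ hm (zpow_mul_eq_one_of_mat (hconj _ hm) h)
    · have h2 := hconj _ hm
      rw [← MonoidHom.coe_fst, map_blockProd] at h2
      exact absurd h2 (blockProd_mat_mem hl hne).2.1
  have hsurj : Function.Surjective f := by
    rw [← MonoidHom.range_eq_top, eq_top_iff, ← closure_mat, Subgroup.closure_le]
    rintro M (rfl | rfl)
    · exact ⟨⟨_, hS⟩, rfl⟩
    · exact ⟨⟨_, hU⟩, rfl⟩
  let e : H ≃* SL(2, ℤ) := MulEquiv.ofBijective f ⟨hinj, hsurj⟩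
  have hval : ∀ x : H, ((MonoidHom.snd SL(2, ℤ) G).comp (H.subtype.comp e.symm.toMonoidHom)) (f x) =
      x.1.2 := fun x => congrArg (fun y : H => y.1.2) (e.symm_apply_apply x)
  exact ⟨_, hval ⟨_, hS⟩, hval ⟨_, hU⟩⟩

theorem monoidHom_ext {G : Type*} [Group G] {θ θ' : SL(2, ℤ) →* G} (hS : θ matS = θ' matS)
    (hU : θ (matR * matS) = θ' (matR * matS)) : θ = θ' := by
  refine MonoidHom.eq_of_eqOn_dense closure_mat ?_
  rintro M (rfl | rfl)
  exacts [hS, hU]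

/-! ### The twisted embedding -/

section Twist

theorem eq_one_of_proportional {M : SL(2, ℤ)} (hp : Proportional (linearTriple M) X) : M = 1 := by
  have h0 := hp 0 2
  have h1 := hp 1 2
  have e1 := congrArg (eval ![1, 0, 1]) h0
  have e2 := congrArg (eval ![0, 1, 1]) h0
  have e3 := congrArg (eval ![1, 0, 1]) h1
  have e4 := congrArg (eval ![0, 1, 1]) h1
  simp [linearTriple] at e1 e2 e3 e4
  ext i j
  fin_cases i <;> fin_cases j
  exacts [e1, e2, e3, e4]

theorem thetaE_injective : Function.Injective thetaE := by
  rw [injective_iff_map_eq_one]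
  intro M hM
  obtain ⟨T, hT, hfwd, -⟩ := represents_thetaE M
  rw [hM] at hT
  have hT1 : mk T = mk BirTriple.one := hT
  have hp := mk_eq_mk.1 hT1
  rw [hfwd] at hp
  exact eq_one_of_proportional hp

theorem linearTriple_neg_one : linearTriple (-1) = ![-X 0, -X 1, X 2] := by
  funext i
  fin_cases i <;> simp [linearTriple]

theorem commute_shear (μ : ℂ) : Commute (thetaE (-1)) (shear μ) := by
  apply mk_eq_mk.2
  change Proportional (comp (linearTriple (-1)) (shearTriple μ))
    (comp (shearTriple μ) (linearTriple (-1)))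
  rw [linearTriple_neg_one]
  refine proportional_of_mul 1 fun i => ?_
  fin_cases i <;> simp [comp, shearTriple]
  ring

/-- For even `k` the involution `(-x : -y : z) = (x : y : -z)` commutes with `ψ'`. -/
theorem commute_psi' {k : ℕ} (hk : 0 < k) (hk_even : Even k) :
    Commute (thetaE (-1)) (psi' k hk) := by
  apply mk_eq_mk.2
  change Proportional (comp (linearTriple (-1)) (psiTriple k 1))
    (comp (psiTriple k 1) (linearTriple (-1)))
  have hodd : Odd (k - 1) := Nat.Even.sub_odd hk hk_even odd_one
  rw [linearTriple_neg_one]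
  refine proportional_of_mul (-1) fun i => ?_
  fin_cases i <;> simp [comp, psiTriple, hk_even.neg_pow, hodd.neg_pow]

theorem commute_psi {k : ℕ} (hk : 0 < k) (hk_even : Even k) (μ : ℂ) :
    Commute (thetaE (matS ^ 2)) (psi k hk μ) := by
  rw [matS_sq]
  exact ((commute_shear μ).mul_right (commute_psi' hk hk_even)).mul_right
    (commute_shear μ).inv_right

theorem modularPair_twist {k : ℕ} (hk : 0 < k) (hk_even : Even k) (μ : ℂ) :
    ModularPair (thetaE matS) (psi k hk μ * thetaE (matR * matS) * (psi k hk μ)⁻¹) where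
  pow_four := by rw [← map_pow, modularPair_mat.pow_four, map_one]
  pow_three := by
    rw [conj_pow, ← map_pow, modularPair_mat.pow_three, map_one, mul_one, mul_inv_cancel]
  comm := by
    rw [← map_pow]
    have h := commute_psi hk hk_even μ
    exact (h.mul_right (modularPair_mat.comm.map thetaE)).mul_right h.inv_right

variable {k : ℕ} {hk : 0 < k} {μ : ℂ} {θ : SL(2, ℤ) →* Cremona}

theorem exists_blockProd_pow {G : Type*} [Group G] (s u : G) {l : List (ℤ × ℤ)} (hl : IsSigned l)
    (n : ℕ) : ∃ l', IsSigned l' ∧ l'.length = l.length * n ∧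
      blockProd s u l' = blockProd s u l ^ n := by
  induction n with
  | zero => exact ⟨[], by simp [IsSigned], by simp, by rw [blockProd_nil, pow_zero]⟩
  | succ n ih =>
    obtain ⟨l', h1, h2, h3⟩ := ih
    refine ⟨l' ++ l, fun p hp => (List.mem_append.1 hp).elim (h1 p) (hl p), ?_, ?_⟩
    · rw [List.length_append, h2, mul_add_one]
    · rw [blockProd_append, h3, pow_succ]

theorem IsTwist.hasDynamicalDegree (h : IsTwist k hk μ θ) (hk2 : 2 ≤ k) (hμ : TrivialIsotropy μ)
    {l : List (ℤ × ℤ)} (hl : IsSigned l) {M : SL(2, ℤ)}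
    (hM : IsConj M (blockProd matS (matR * matS) l)) :
    HasDynamicalDegree (θ M) ((k : ℝ) ^ (2 * l.length)) := by
  obtain ⟨g, hg⟩ := isConj_iff.1 (θ.map_isConj hM.symm)
  rw [map_blockProd, h.1, h.2] at hg
  rw [← hg]
  have := hasDynamicalDegree_of_degree_pow (g := g) (pow_pos hk (2 * l.length)) fun n => by
    obtain ⟨l', h1, h2, h3⟩ := exists_blockProd_pow (thetaE matS)
      (psi k hk μ * thetaE (matR * matS) * (psi k hk μ)⁻¹) hl n
    rw [← h3, degree_blockProd hk hk2 hμ l' h1, h2, ← pow_mul, mul_assoc]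
  simpa only [Nat.cast_pow] using this

theorem IsTwist.map_mul_zpow (h : IsTwist k hk μ θ) (hk_even : Even k) (m i : ℤ) :
    θ (matS ^ (2 * m) * (matR * matS) ^ i) =
      psi k hk μ * thetaE (matS ^ (2 * m) * (matR * matS) ^ i) * (psi k hk μ)⁻¹ := by
  have hc : Commute (thetaE (matS ^ (2 * m))) (psi k hk μ) := by
    rw [zpow_mul, map_zpow]
    exact (commute_psi hk hk_even μ).zpow_left m
  rw [map_mul, map_zpow, map_zpow, h.1, h.2, conj_zpow, ← map_zpow, ← map_zpow, map_mul,
    ← mul_assoc, ← mul_assoc, ← mul_assoc, hc.eq]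

/-- Elements of `SL(2, ℤ)` either have finite order, and are then detected by a twisted embedding,
or are conjugate to a non-empty product of blocks. -/
theorem IsTwist.dichotomy (h : IsTwist k hk μ θ) (hk_even : Even k) (M : SL(2, ℤ)) :
    (IsOfFinOrder (θ M) ∧ (θ M = 1 → M = 1)) ∨
      ∃ l, IsSigned l ∧ l ≠ [] ∧ IsConj M (blockProd matS (matR * matS) l) := by
  have hS : IsOfFinOrder matS :=
    isOfFinOrder_iff_pow_eq_one.2 ⟨4, by omega, modularPair_mat.pow_four⟩
  have hU : IsOfFinOrder (matR * matS) :=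
    isOfFinOrder_iff_pow_eq_one.2 ⟨3, by omega, modularPair_mat.pow_three⟩
  have key : ∀ N : SL(2, ℤ), IsConj M N → IsOfFinOrder N → (θ N = 1 → N = 1) →
      IsOfFinOrder (θ M) ∧ (θ M = 1 → M = 1) := by
    intro N hN hfin h1
    refine ⟨?_, fun hM => ?_⟩
    · obtain ⟨g, rfl⟩ := isConj_iff.1 hN.symm
      exact θ.isOfFinOrder ((MulAut.conj g).toMonoidHom.isOfFinOrder hfin)
    · have hθ := θ.map_isConj hN
      rw [hM] at hθ
      rw [h1 (isConj_one_right.1 hθ)] at hN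
      exact isConj_one_left.1 hN
  rcases modularPair_mat.isConj_cases (closure_mat ▸ Subgroup.mem_top M) with
    ⟨m, hm⟩ | ⟨m, i, hm⟩ | hw
  · refine Or.inl (key _ hm hS.zpow fun h1 => thetaE_injective ?_)
    rw [map_one, map_zpow, ← h.1, ← map_zpow, h1]
  · refine Or.inl (key _ hm ?_ fun h1 => thetaE_injective ?_)
    · exact ((modularPair_mat.commute_zpow m i)).isOfFinOrder_mul hS.zpow hU.zpow
    · rw [h.map_mul_zpow hk_even, mul_inv_eq_one, mul_eq_left] at h1
      rw [h1, map_one]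
  · exact Or.inr hw

theorem word_eq_blockProd {m : ℕ} (a b : Fin m → ℤ) :
    word a b = blockProd matS (matR * matS) (List.ofFn fun i => (b i, a i)).reverse := by
  rw [word, blockProd, List.map_reverse, List.map_ofFn]
  rfl

end Twist

end Cremona


theorem mainTheorem3 (k : ℕ) (hk : 0 < k) (hk_even : Even k) (μ : ℂ) (hμ0 : μ ≠ 0)
    (hμ : Cremona.TrivialIsotropy μ) :
    ∃ θ : SL(2, ℤ) →* Cremona,
      (Cremona.IsTwist k hk μ θ ∧
        ∀ θ' : SL(2, ℤ) →* Cremona, Cremona.IsTwist k hk μ θ' → θ' = θ) ∧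
      (∀ (m : ℕ), 0 < m → ∀ a b : Fin m → ℤ,
        (∀ i, a i = 1 ∨ a i = -1) → (∀ i, b i = 1 ∨ b i = -1) →
        Cremona.HasDynamicalDegree (θ (Cremona.word a b)) ((k : ℝ) ^ (2 * m))) ∧
      Cremona.IsHyperbolicEmbedding θ ∧
      (∀ M : SL(2, ℤ), ∃ l : ℝ, Cremona.HasDynamicalDegree (θ M) l) ∧
      {l : ℝ | ∃ f ∈ θ.range, Cremona.HasDynamicalDegree f l} =
        {l : ℝ | ∃ j : ℕ, l = (k : ℝ) ^ (2 * j)} := by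
  have hk2 : 2 ≤ k := by
    obtain ⟨j, hj⟩ := hk_even
    omega
  obtain ⟨θ, hθ⟩ := Cremona.exists_monoidHom (Cremona.modularPair_twist hk hk_even μ)
  have hT : Cremona.IsTwist k hk μ θ := hθ
  have hlt : ∀ l : List (ℤ × ℤ), l ≠ [] → (1 : ℝ) < (k : ℝ) ^ (2 * l.length) := fun l hl => by
    have h1 : (1 : ℝ) < k := by exact_mod_cast hk2
    have h2 := List.length_pos_iff.2 hl
    exact one_lt_pow₀ h1 (by omega)
  have hdyn : ∀ M, ∃ j : ℕ, Cremona.HasDynamicalDegree (θ M) ((k : ℝ) ^ (2 * j)) := by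
    intro M
    rcases hT.dichotomy hk_even M with ⟨hfin, -⟩ | ⟨l, hl, -, hM⟩
    · exact ⟨0, by simpa using Cremona.hasDynamicalDegree_of_isOfFinOrder hfin⟩
    · exact ⟨_, hT.hasDynamicalDegree hk2 hμ hl hM⟩
  refine ⟨θ, ⟨hT, fun θ' hθ' => Cremona.monoidHom_ext (hθ'.1.trans hT.1.symm)
    (hθ'.2.trans hT.2.symm)⟩, ?_, ⟨?_, ?_⟩, fun M => ⟨_, (hdyn M).choose_spec⟩, ?_⟩
  · intro m _ a b ha hb
    have hl : Cremona.IsSigned (List.ofFn fun i => (b i, a i)).reverse := by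
      intro p hp
      rw [List.mem_reverse, List.mem_ofFn] at hp
      obtain ⟨i, rfl⟩ := hp
      exact ⟨hb i, ha i⟩
    have := hT.hasDynamicalDegree hk2 hμ hl (IsConj.refl _)
    rwa [← Cremona.word_eq_blockProd, List.length_reverse, List.length_ofFn] at this
  · rw [injective_iff_map_eq_one]
    intro M hM
    rcases hT.dichotomy hk_even M with ⟨-, h1⟩ | ⟨l, hl, hne, hconj⟩
    · exact h1 hM
    · -- a product of blocks has dynamical degree greater than `1`
      have h1 := hT.hasDynamicalDegree hk2 hμ hl hconj
      rw [hM] at h1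
      exact absurd (tendsto_nhds_unique h1 (Cremona.hasDynamicalDegree_of_isOfFinOrder .one))
        (hlt l hne).ne'
  · rintro _ ⟨M, rfl⟩ hinf
    rcases hT.dichotomy hk_even M with ⟨hfin, -⟩ | ⟨l, hl, hne, hconj⟩
    · exact absurd hfin hinf
    · exact ⟨_, hlt l hne, hT.hasDynamicalDegree hk2 hμ hl hconj⟩
  · ext d
    constructor
    · rintro ⟨_, ⟨M, rfl⟩, hd⟩
      obtain ⟨j, hj⟩ := hdyn M
      exact ⟨j, tendsto_nhds_unique hd hj⟩
    · rintro ⟨j, rfl⟩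
      have hl : Cremona.IsSigned (List.replicate j (1, 1)) := fun p hp => by
        rw [List.eq_of_mem_replicate hp]
        exact ⟨Or.inl rfl, Or.inl rfl⟩
      have := hT.hasDynamicalDegree hk2 hμ hl (IsConj.refl _)
      rw [List.length_replicate] at this
      exact ⟨_, ⟨_, rfl⟩, this⟩
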